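/- Let $\mathbb{D}$ be the open unit disc and $\mathbb{T}$ the unit circle in $\mathbb{C}$. For an arc $I\subseteq\mathbb{T}$ (always of positive length) let $|I|=\int_I\frac{|d\zeta|}{2\pi}\in(0,1]$ be its normalized length, and for $f\in L^2(\mathbb{T})$ (complex-valued) let $f_I=|I|^{-1}\int_I f(\zeta)\frac{|d\zeta|}{2\pi}$. All suprema below are over all arcs $I\subseteq\mathbb{T}$. For $\frac12<\beta<1$, $BMO^{\beta}(\mathbb{T})$ is the space of $f\in L^2(\mathbb{T})$ with $$\sup_{I}|I|^{4\beta-5}\int_I|f(e^{is})-f_I|^2\,ds<\infty .$$ For $0<p<1$ and $\frac12<\beta<1$, $Q_p^{\beta}(\mathbb{T})$ is the space of $f\in L^2(\mathbb{T})$ with $$\sup_{I}\left(|I|^{2\beta-2-p}\int_I\int_I\frac{|f(\zeta)-f(\eta)|^2}{|\zeta-\eta|^{4-p-2\beta}}\,|d\zeta|\,|d\eta|\right)^{1/2}<\infty .$$ The Poisson integral of $f$ is $\hat f(z)=\int_{\mathbb{T}}f(\zeta)\frac{1-|z|^2}{|\zeta-z|^2}\frac{|d\zeta|}{2\pi}$,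 $z\in\mathbb{D}$. Write $\nabla=(2\partial/\partial z,\,2\partial/\partial\bar z)$, so that $|\nabla\hat f|^2=4|\partial\hat f/\partial z|^2+4|\partial\hat f/\partial\bar z|^2$, and $dA=\frac1\pi\,dx\,dy$. For $q>0$, a positive Borel measure $\mu$ on $\mathbb{D}$ is a $q$-Carleson measure if $\sup_{I}\mu(S(I))/|I|^{q}<\infty$, where $S(I)=\{z\in\mathbb{D}:\ 1-|I|\le|z|<1,\ z/|z|\in I\}$. **Theorem.** Let $0<p<1$, $\frac12<\beta<1$ and $p-2+2\beta>0$, and let $f\in BMO^{\beta}(\mathbb{T})$. The following conditions are equivalent: 1. $f\in Q_p^{\beta}(\mathbb{T})$; 2. $$\sup_{I}|I|^{2\beta-p-2}\int_0^{|I|}\left(\int_I|f(e^{i(s+t)})-f(e^{is})|^2\,ds\right)\frac{dt}{t^{4-p-2\beta}}<\infty;$$ 3. $|\nabla\hat f(z)|^2(1-|z|^2)^{p-2+2\beta}\,dA(z)$ is a $(p+2-2\beta)$-Carleson measure. -/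

import Mathlib

noncomputable section

namespace CircleQ

open MeasureTheory Set

/-- An open arc `{e^{is} : left < s < right}` of the unit circle, of positive length and at most one
full turn. (Replacing open arcs by closed or half-open ones changes each set by at most two
points.) -/
structure Arc where
  left : ℝ
  right : ℝ
  left_lt_right : left < right
  right_le : right ≤ left + 2 * Real.pi

namespace Arc

/-- The interval of angles parametrizing the arc. -/
def angles (I : Arc) : Set ℝ := Ioo I.left I.right

/-- The arc as a subset of the unit circle. -/
def toSet (I : Arc) : Set Circle := Circle.exp '' I.angles

/-- The normalized length `|I| = ∫_I |dζ| / 2π`, a number in `(0, 1]`. -/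
def len (I : Arc) : ℝ := (I.right - I.left) / (2 * Real.pi)

/-- The Carleson box `S(I) = {z ∈ 𝔻 : 1 - |I| ≤ |z| < 1, z / |z| ∈ I}`. -/
def box (I : Arc) : Set ℂ :=
  {z | 1 - I.len ≤ ‖z‖ ∧ ‖z‖ < 1 ∧ ∃ ζ ∈ I.toSet, z / (‖z‖ : ℂ) = (ζ : ℂ)}

/-- The mean value `f_I` of `f` over the arc `I`. -/
def mean (I : Arc) (f : Circle → ℂ) : ℂ := ⨍ s in I.angles, f (Circle.exp s)

end Arc

/-- `f ∈ L²(𝕋)`, with respect to arc length. -/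
def MemL2 (f : Circle → ℂ) : Prop :=
  MemLp (fun s : ℝ => f (Circle.exp s)) 2 (volume.restrict (Ioc 0 (2 * Real.pi)))

/-- `‖f‖²_{BMO^β(𝕋)} = sup_I |I|^{4β-5} ∫_I |f(e^{is}) - f_I|² ds`. -/
def bmoSeminormSq (β : ℝ) (f : Circle → ℂ) : ENNReal :=
  ⨆ I : Arc, ENNReal.ofReal (I.len ^ (4 * β - 5)) *
    ∫⁻ s in I.angles, ENNReal.ofReal (‖f (Circle.exp s) - I.mean f‖ ^ 2)

/-- The space `BMO^β(𝕋)`. -/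
def MemBMO (β : ℝ) (f : Circle → ℂ) : Prop :=
  MemL2 f ∧ bmoSeminormSq β f < ⊤

/-- `‖f‖_{Q_p^β(𝕋)} = sup_I (|I|^{2β-2-p} ∫_I ∫_I |f(ζ)-f(η)|² / |ζ-η|^{4-p-2β} |dζ||dη|)^{1/2}`. -/
def qSeminorm (p β : ℝ) (f : Circle → ℂ) : ENNReal :=
  ⨆ I : Arc, (ENNReal.ofReal (I.len ^ (2 * β - 2 - p)) *
    ∫⁻ t in I.angles, ∫⁻ s in I.angles,
      ENNReal.ofReal (‖f (Circle.exp s) - f (Circle.exp t)‖ ^ 2 /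
        ‖(Circle.exp s : ℂ) - (Circle.exp t : ℂ)‖ ^ (4 - p - 2 * β))) ^ (1 / 2 : ℝ)

/-- The space `Q_p^β(𝕋)`. -/
def MemQ (p β : ℝ) (f : Circle → ℂ) : Prop :=
  MemL2 f ∧ qSeminorm p β f < ⊤

/-- `sup_I |I|^{2β-p-2} ∫_0^{|I|} (∫_I |f(e^{i(s+t)}) - f(e^{is})|² ds) dt / t^{4-p-2β}`. -/
def translationSup (p β : ℝ) (f : Circle → ℂ) : ENNReal :=
  ⨆ I : Arc, ENNReal.ofReal (I.len ^ (2 * β - p - 2)) *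
    ∫⁻ t in Ioo 0 I.len,
      (∫⁻ s in I.angles, ENNReal.ofReal (‖f (Circle.exp (s + t)) - f (Circle.exp s)‖ ^ 2)) /
        ENNReal.ofReal (t ^ (4 - p - 2 * β))

/-- The Poisson integral `f̂(z) = ∫_𝕋 f(ζ) (1-|z|²)/|ζ-z|² |dζ|/2π` (used for `|z| < 1`). -/
def poissonIntegral (f : Circle → ℂ) (z : ℂ) : ℂ :=
  (1 / (2 * Real.pi) : ℝ) •
    ∫ s in Ioc 0 (2 * Real.pi), poissonKernel 0 z (Circle.exp s : ℂ) • f (Circle.exp s)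

/-- `∂F/∂z = (∂F/∂x - i ∂F/∂y) / 2`. -/
def dz (F : ℂ → ℂ) (z : ℂ) : ℂ :=
  (fderiv ℝ F z 1 - Complex.I * fderiv ℝ F z Complex.I) / 2

/-- `∂F/∂z̄ = (∂F/∂x + i ∂F/∂y) / 2`. -/
def dzbar (F : ℂ → ℂ) (z : ℂ) : ℂ :=
  (fderiv ℝ F z 1 + Complex.I * fderiv ℝ F z Complex.I) / 2

/-- `|∇F|²`, where `∇ = (2 ∂/∂z, 2 ∂/∂z̄)`. -/
def gradSq (F : ℂ → ℂ) (z : ℂ) : ℝ :=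
  ‖2 * dz F z‖ ^ 2 + ‖2 * dzbar F z‖ ^ 2

/-- The normalized area measure `dA = dx dy / π` on the unit disc. -/
def areaMeasure : Measure ℂ :=
  ENNReal.ofReal (1 / Real.pi) • volume.restrict (Metric.ball (0 : ℂ) 1)

/-- `μ` is a `q`-Carleson measure: `sup_I μ(S(I)) / |I|^q < ∞`. -/
def IsCarleson (q : ℝ) (μ : Measure ℂ) : Prop :=
  (⨆ I : Arc, μ I.box / ENNReal.ofReal (I.len ^ q)) < ⊤

/-- The measure `|∇f̂(z)|² (1-|z|²)^{p-2+2β} dA(z)` on the unit disc. -/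
def gradMeasure (p β : ℝ) (f : Circle → ℂ) : Measure ℂ :=
  areaMeasure.withDensity fun z =>
    ENNReal.ofReal (gradSq (poissonIntegral f) z * (1 - ‖z‖ ^ 2) ^ (p - 2 + 2 * β))

end CircleQ

end

/-!
A function in `BMO^β(𝕋)` agrees almost everywhere with a Hölder continuous one of exponent
`α = 2 - 2β ∈ (0, 1)` (Campanato's theorem, `MemBMO.exists_holder`). All three conditions depend
only on the class of `f` modulo null sets, so `f` may be replaced by a `2π`-periodic `g : ℝ → ℂ` with
`|g(x) - g(y)| ≤ M |x - y|^α`. Put `σ = p - 2 + 2β`, which lies in `(0, 1)`; the exponent of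
`|I|` in all conditions is `p + 2 - 2β = σ + 2α`, and `ArcBound (σ + 2α) X` says that
`X(I) ≤ C |I|^{σ + 2α}` for all arcs. The Hölder condition gives this bound for the part of a double
integral over pairs of points whose distance is comparable to `|I|` or larger, so that only the
pairs of nearby points matter.

* Chords and angles. The chord `|ζ - η|` is comparable to the difference of the angles, unless the
  arc is so long that its ends come close to each other. For such an arc the integral is at most
  that over the whole circle, which two half circles for the first variable make up
  (`ArcBound.chordEnergy_of_diffEnergy`).
* Double integrals and translations. With `u = s + t` the integral over `I × I` becomes one over `s`
  and `t`; in the translation form `s + t` may leave `I`, but each half of `I`, moved by at most a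
  quarter of `I`, stays in a rotate of `I` (`ArcBound.shiftEnergy_of_diffEnergy`,
  `ArcBound.diffEnergy_of_shiftEnergy`).
* From differences to the gradient. The Poisson kernel is the real part of the Herglotz kernel, and
  `2ζ / (ζ - z)²` has mean zero on the circle, so at `z = (1 - y) e^{iθ}` the gradient is at most a
  constant times `∫ |g(θ + t) - g(θ)| / (y² + t²) dt`. The weighted inequality
  `exists_lintegral_sq_kernel_le`, valid for `0 < σ < 1`, bounds the integral of its square
  against `y^σ dy` by a multiple of `∫ |g(θ + t) - g(θ)|² t^{σ - 2} dt`; the values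
  `|t| ≳ |I|` are controlled by the Hölder condition (`ArcBound.gradEnergy_of_diffEnergy`).
* From the gradient to differences. Join `e^{is}` to `e^{i(s + t)}` by going along a radius to depth
  `t`, along the circle at that depth, and back along a radius. Hardy's inequality
  `exists_hardy_le` estimates the radial parts and Cauchy–Schwarz the circular one
  (`ArcBound.shiftEnergy_of_gradEnergy`).

In polar coordinates the measure of a Carleson box is comparable to the integral of
`|∇ĝ|² y^σ` over the angles of `I` and `0 < y < |I|` (`gradMeasure_box_le`); for the converse
direction the half `y < |I| / 2` of the box is enough (`gradEnergy_le_gradMeasure_box`).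
-/

namespace CircleQ

open MeasureTheory Set Filter Topology

/-! ### Weighted inequalities on the half-line -/

/-- Cauchy–Schwarz with weights: if `w² ≤ u v` pointwise, then `(∫ φ w)² ≤ (∫ φ² u) (∫ v)`. -/
lemma sq_lintegral_mul_le {X : Type*} [MeasurableSpace X] {μ : Measure X} {φ w u v : X → ENNReal}
    (hφ : AEMeasurable φ μ) (hu : Measurable u) (hv : Measurable v)
    (h : ∀ᵐ x ∂μ, w x ^ 2 ≤ u x * v x) :
    (∫⁻ x, φ x * w x ∂μ) ^ 2 ≤ (∫⁻ x, φ x ^ 2 * u x ∂μ) * ∫⁻ x, v x ∂μ := by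
  have hroot : ∀ a : ENNReal, (a ^ (1 / 2 : ℝ)) ^ (2 : ℝ) = a := fun a => by
    rw [← ENNReal.rpow_mul]; norm_num
  have h1 : ∫⁻ x, φ x * w x ∂μ ≤
      ∫⁻ x, ((fun x => φ x * u x ^ (1 / 2 : ℝ)) * fun x => v x ^ (1 / 2 : ℝ)) x ∂μ := by
    refine lintegral_mono_ae (h.mono fun x hx => ?_)
    simp only [Pi.mul_apply]
    rw [mul_assoc, ← ENNReal.mul_rpow_of_nonneg _ _ (by norm_num)]
    gcongr
    rw [← ENNReal.rpow_natCast] at hx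
    calc w x = (w x ^ ((2 : ℕ) : ℝ)) ^ (1 / 2 : ℝ) := by rw [← ENNReal.rpow_mul]; norm_num
      _ ≤ _ := ENNReal.rpow_le_rpow hx (by norm_num)
  have h2 := h1.trans (ENNReal.lintegral_mul_le_Lp_mul_Lq μ
    (Real.HolderConjugate.two_two) (hφ.mul (hu.pow_const _).aemeasurable)
    (hv.pow_const _).aemeasurable)
  calc (∫⁻ x, φ x * w x ∂μ) ^ 2 ≤ _ := pow_le_pow_left' h2 2
    _ = _ := by
      rw [← ENNReal.rpow_natCast, ENNReal.mul_rpow_of_nonneg _ _ (by norm_num)]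
      simp only [Nat.cast_ofNat, hroot]
      congr 1
      refine lintegral_congr fun x => ?_
      rw [ENNReal.mul_rpow_of_nonneg _ _ (by norm_num), hroot]
      norm_cast

lemma setLIntegral_Ioo_rpow {c x : ℝ} (hc : -1 < c) (hx : 0 ≤ x) :
    ∫⁻ t in Ioo 0 x, ENNReal.ofReal (t ^ c) = ENNReal.ofReal (x ^ (c + 1) / (c + 1)) := by
  rw [setLIntegral_congr Ioo_ae_eq_Ioc, ← ofReal_integral_eq_lintegral_ofReal,
    ← intervalIntegral.integral_of_le hx, integral_rpow (Or.inl hc),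
    Real.zero_rpow (by linarith), sub_zero]
  · exact (intervalIntegrable_iff_integrableOn_Ioc_of_le hx).1
      (intervalIntegral.intervalIntegrable_rpow' hc)
  · filter_upwards [ae_restrict_mem measurableSet_Ioc] with t ht
    exact Real.rpow_nonneg ht.1.le _

lemma setLIntegral_Ioi_rpow {c x : ℝ} (hc : c < -1) (hx : 0 < x) :
    ∫⁻ t in Ioi x, ENNReal.ofReal (t ^ c) = ENNReal.ofReal (x ^ (c + 1) / (-(c + 1))) := by
  rw [← ofReal_integral_eq_lintegral_ofReal, integral_Ioi_rpow_of_lt hc hx, div_neg, neg_div]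
  · exact integrableOn_Ioi_rpow_of_lt hc hx
  · filter_upwards [ae_restrict_mem measurableSet_Ioi] with t ht
    exact Real.rpow_nonneg (hx.trans ht).le _

/-- The kernel is at most `y⁻²` for `t ≤ y` and at most `t⁻²` for `t > y`. -/
lemma setLIntegral_rpow_mul_kernel_le {a y : ℝ} (ha0 : 0 < a) (ha1 : a < 1) (hy : 0 < y) :
    ∫⁻ t in Ioi 0, ENNReal.ofReal (t ^ (-a) * (y ^ 2 + t ^ 2)⁻¹) ≤
      ENNReal.ofReal ((1 / (1 - a) + 1 / (1 + a)) * y ^ (-a - 1)) := by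
  have hcov : Ioi (0 : ℝ) = Ioc 0 y ∪ Ioi y := (Ioc_union_Ioi_eq_Ioi hy.le).symm
  rw [hcov]
  refine (lintegral_union_le _ _ _).trans ?_
  have e1 : ∫⁻ t in Ioc 0 y, ENNReal.ofReal (t ^ (-a) * (y ^ 2 + t ^ 2)⁻¹) ≤
      ENNReal.ofReal (1 / (1 - a) * y ^ (-a - 1)) := by
    calc _ ≤ ∫⁻ t in Ioc 0 y, ENNReal.ofReal (y ^ (-2 : ℝ)) * ENNReal.ofReal (t ^ (-a)) := by
          refine setLIntegral_mono' measurableSet_Ioc fun t ht => ?_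
          rw [← ENNReal.ofReal_mul (by positivity), mul_comm]
          apply ENNReal.ofReal_le_ofReal
          have : y ^ (-2 : ℝ) = (y ^ 2)⁻¹ := by
            rw [Real.rpow_neg hy.le]; norm_cast
          rw [this]
          have := ht.1
          gcongr
          nlinarith
      _ = _ := by
          rw [lintegral_const_mul' _ _ ENNReal.ofReal_ne_top,
            setLIntegral_congr Ioo_ae_eq_Ioc.symm, setLIntegral_Ioo_rpow (by linarith) hy.le,
            ← ENNReal.ofReal_mul (by positivity)]
          congr 1
          rw [mul_div_assoc', ← Real.rpow_add hy]
          rw [show -2 + (-a + 1) = -a - 1 by ring, show -a + 1 = 1 - a by ring]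
          ring
  have e2 : ∫⁻ t in Ioi y, ENNReal.ofReal (t ^ (-a) * (y ^ 2 + t ^ 2)⁻¹) ≤
      ENNReal.ofReal (1 / (1 + a) * y ^ (-a - 1)) := by
    calc _ ≤ ∫⁻ t in Ioi y, ENNReal.ofReal (t ^ (-a - 2)) := by
          refine setLIntegral_mono' measurableSet_Ioi fun t ht => ?_
          have ht0 : 0 < t := hy.trans ht
          apply ENNReal.ofReal_le_ofReal
          rw [show -a - 2 = -a + (-2 : ℝ) by ring, Real.rpow_add ht0]
          have : t ^ (-2 : ℝ) = (t ^ 2)⁻¹ := by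
            rw [Real.rpow_neg ht0.le]; norm_cast
          rw [this]
          gcongr
          nlinarith
      _ = _ := by
          rw [setLIntegral_Ioi_rpow (by linarith) hy]
          rw [show -a - 2 + 1 = -a - 1 by ring, show -(-a - 1) = 1 + a by ring]
          congr 1; ring
  refine (add_le_add e1 e2).trans ?_
  rw [← ENNReal.ofReal_add (by positivity) (by positivity), add_mul]

/-- The kernel `1 / (y² + t²)` maps `L²((0,T), t^{σ-2} dt)` boundedly to
`L²((0,∞), y^σ dy)`. Cauchy–Schwarz against the power `t^{σ/2}` reduces this to
`setLIntegral_rpow_mul_kernel_le`, used once in each variable. -/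
lemma exists_lintegral_sq_kernel_le {σ : ℝ} (h0 : 0 < σ) (h1 : σ < 1) :
    ∃ C : ENNReal, C ≠ ⊤ ∧ ∀ (T : ℝ) (φ : ℝ → ENNReal), Measurable φ →
      ∫⁻ y in Ioi 0, (∫⁻ t in Ioo 0 T, φ t * ENNReal.ofReal (y ^ 2 + t ^ 2)⁻¹) ^ 2 *
        ENNReal.ofReal (y ^ σ) ≤
      C * ∫⁻ t in Ioo 0 T, φ t ^ 2 * ENNReal.ofReal (t ^ (σ - 2)) := by
  set a := σ / 2 with ha
  set A : ℝ := 1 / (1 - a) + 1 / (1 + a)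
  set B : ℝ := 1 / (1 - (1 - a)) + 1 / (1 + (1 - a))
  have hA0 : 0 ≤ A := by
    have : 0 < 1 - a := by rw [ha]; linarith
    positivity
  have hB0 : 0 ≤ B := by
    have : 0 < 1 - a := by rw [ha]; linarith
    have : 0 < 1 - (1 - a) := by rw [ha]; linarith
    positivity
  refine ⟨ENNReal.ofReal A * ENNReal.ofReal B, by finiteness, fun T φ hφ => ?_⟩
  have hm : Measurable fun p : ℝ × ℝ => ENNReal.ofReal (p.2 ^ a * (p.1 ^ 2 + p.2 ^ 2)⁻¹) := by
    fun_prop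
  -- the inner integral, for a fixed `y`
  have key : ∀ y ∈ Ioi (0 : ℝ),
      (∫⁻ t in Ioo 0 T, φ t * ENNReal.ofReal (y ^ 2 + t ^ 2)⁻¹) ^ 2 * ENNReal.ofReal (y ^ σ) ≤
      ENNReal.ofReal A * ∫⁻ t in Ioo 0 T, φ t ^ 2 *
        ENNReal.ofReal (t ^ a * (y ^ (a - 1) * (y ^ 2 + t ^ 2)⁻¹)) := by
    intro y hy
    have hy : 0 < y := hy
    have cs := sq_lintegral_mul_le (μ := volume.restrict (Ioo 0 T)) (φ := φ)
      (w := fun t => ENNReal.ofReal (y ^ 2 + t ^ 2)⁻¹)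
      (u := fun t => ENNReal.ofReal (t ^ a * (y ^ 2 + t ^ 2)⁻¹))
      (v := fun t => ENNReal.ofReal (t ^ (-a) * (y ^ 2 + t ^ 2)⁻¹)) hφ.aemeasurable
      (by fun_prop) (by fun_prop)
      (by
        filter_upwards [ae_restrict_mem measurableSet_Ioo] with t ht
        have := ht.1
        rw [← ENNReal.ofReal_mul (by positivity), ← ENNReal.ofReal_pow (by positivity)]
        apply le_of_eq
        congr 1
        rw [Real.rpow_neg ht.1.le]
        field_simp)
    have hk : ∫⁻ t in Ioo 0 T, ENNReal.ofReal (t ^ (-a) * (y ^ 2 + t ^ 2)⁻¹) ≤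
        ENNReal.ofReal (A * y ^ (-a - 1)) :=
      (lintegral_mono_set Ioo_subset_Ioi_self).trans
        (setLIntegral_rpow_mul_kernel_le (by positivity) (by linarith) hy)
    calc _ ≤ (∫⁻ t in Ioo 0 T, φ t ^ 2 * ENNReal.ofReal (t ^ a * (y ^ 2 + t ^ 2)⁻¹)) *
          ENNReal.ofReal (A * y ^ (-a - 1)) * ENNReal.ofReal (y ^ σ) := by
          gcongr
          exact cs.trans (by gcongr)
      _ = ENNReal.ofReal A * ((∫⁻ t in Ioo 0 T, φ t ^ 2 *
          ENNReal.ofReal (t ^ a * (y ^ 2 + t ^ 2)⁻¹)) * ENNReal.ofReal (y ^ (a - 1))) := by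
          rw [ENNReal.ofReal_mul hA0, mul_assoc, mul_assoc, ← ENNReal.ofReal_mul (by positivity),
            ← Real.rpow_add hy, show -a - 1 + σ = a - 1 by rw [ha]; ring, mul_left_comm]
      _ = _ := by
          rw [← lintegral_mul_const' _ _ ENNReal.ofReal_ne_top]
          congr 1
          refine setLIntegral_congr_fun measurableSet_Ioo fun t ht => ?_
          have := ht.1
          rw [mul_assoc, ← ENNReal.ofReal_mul (by positivity)]
          congr 2; ring
  refine (setLIntegral_mono' measurableSet_Ioi key).trans ?_
  rw [lintegral_const_mul' _ _ ENNReal.ofReal_ne_top, mul_assoc]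
  gcongr
  rw [lintegral_lintegral_swap (by fun_prop), ← lintegral_const_mul' _ _ ENNReal.ofReal_ne_top]
  refine setLIntegral_mono' measurableSet_Ioo fun t ht => ?_
  have ht0 := ht.1
  calc _ = φ t ^ 2 * (ENNReal.ofReal (t ^ a) *
        ∫⁻ y in Ioi 0, ENNReal.ofReal (y ^ (-(1 - a)) * (t ^ 2 + y ^ 2)⁻¹)) := by
        rw [lintegral_const_mul _ (by fun_prop)]
        congr 1
        rw [← lintegral_const_mul' _ _ ENNReal.ofReal_ne_top]
        refine lintegral_congr fun y => ?_
        rw [← ENNReal.ofReal_mul (by positivity)]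
        congr 2
        ring_nf
    _ ≤ φ t ^ 2 * (ENNReal.ofReal (t ^ a) * ENNReal.ofReal (B * t ^ (-(1 - a) - 1))) := by
        gcongr
        exact setLIntegral_rpow_mul_kernel_le (by linarith) (by linarith) ht0
    _ = _ := by
        rw [mul_left_comm (ENNReal.ofReal B)]
        congr 1
        rw [← ENNReal.ofReal_mul (by positivity), ← ENNReal.ofReal_mul hB0]
        congr 1
        rw [mul_left_comm, ← Real.rpow_add ht0]
        congr 2
        rw [ha]; ring

/-- **Hardy's inequality** for the weights `t^{σ-2}` and `y^σ`, `σ < 1`. With `b`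
halfway between `σ` and `1`, Cauchy–Schwarz with the powers `y^{±b}` bounds the square of the inner
integral; then the order of integration is exchanged. -/
lemma exists_hardy_le {σ : ℝ} (h1 : σ < 1) :
    ∃ C : ENNReal, C ≠ ⊤ ∧ ∀ (T : ℝ) (φ : ℝ → ENNReal), Measurable φ →
      ∫⁻ t in Ioo 0 T, (∫⁻ y in Ioo 0 t, φ y) ^ 2 * ENNReal.ofReal (t ^ (σ - 2)) ≤
      C * ∫⁻ y in Ioo 0 T, φ y ^ 2 * ENNReal.ofReal (y ^ σ) := by
  set b := (1 + σ) / 2 with hb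
  have hb1 : 0 < 1 - b := by rw [hb]; linarith
  have hb2 : 0 < b - σ := by rw [hb]; linarith
  refine ⟨ENNReal.ofReal (1 / (1 - b)) * ENNReal.ofReal (1 / (b - σ)), by finiteness,
    fun T φ hφ => ?_⟩
  have key : ∀ t ∈ Ioo 0 T, (∫⁻ y in Ioo 0 t, φ y) ^ 2 * ENNReal.ofReal (t ^ (σ - 2)) ≤
      ENNReal.ofReal (1 / (1 - b)) * ∫⁻ y in Ioo 0 T, (Iio t).indicator (fun y => φ y ^ 2 *
        ENNReal.ofReal (y ^ b)) y * ENNReal.ofReal (t ^ (σ - 1 - b)) := by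
    intro t ht
    have ht0 := ht.1
    have cs := sq_lintegral_mul_le (μ := volume.restrict (Ioo 0 t)) (φ := φ)
      (w := fun _ => 1)
      (u := fun y => ENNReal.ofReal (y ^ b))
      (v := fun y => ENNReal.ofReal (y ^ (-b))) hφ.aemeasurable (by fun_prop) (by fun_prop)
      (by
        filter_upwards [ae_restrict_mem measurableSet_Ioo] with y hy
        have := hy.1
        rw [← ENNReal.ofReal_mul (by positivity), ← Real.rpow_add hy.1]
        simp)
    rw [setLIntegral_Ioo_rpow (by linarith) ht0.le] at cs
    simp only [mul_one] at cs
    calc _ ≤ (∫⁻ y in Ioo 0 t, φ y ^ 2 * ENNReal.ofReal (y ^ b)) *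
          ENNReal.ofReal (t ^ (-b + 1) / (-b + 1)) * ENNReal.ofReal (t ^ (σ - 2)) := by
          gcongr
      _ = ENNReal.ofReal (1 / (1 - b)) * ((∫⁻ y in Ioo 0 t, φ y ^ 2 * ENNReal.ofReal (y ^ b)) *
          ENNReal.ofReal (t ^ (σ - 1 - b))) := by
          rw [mul_assoc, mul_left_comm (ENNReal.ofReal _), show -b + 1 = 1 - b by ring,
            ← ENNReal.ofReal_mul (by positivity), ← ENNReal.ofReal_mul (by positivity)]
          congr 2
          rw [show σ - 1 - b = (1 - b) + (σ - 2) by ring, Real.rpow_add ht0 (1 - b)]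
          ring
      _ = _ := by
          rw [lintegral_mul_const' _ _ ENNReal.ofReal_ne_top]
          rw [setLIntegral_indicator measurableSet_Iio]
          congr 4
          ext y
          simp only [mem_Ioo, mem_inter_iff, mem_Iio]
          constructor
          · rintro ⟨h, h'⟩; exact ⟨h', h, h'.trans ht.2⟩
          · rintro ⟨h, h', -⟩; exact ⟨h', h⟩
  refine (setLIntegral_mono' measurableSet_Ioo key).trans ?_
  rw [lintegral_const_mul' _ _ ENNReal.ofReal_ne_top, mul_assoc]
  gcongr
  have hmeas : Measurable (Function.uncurry fun t y : ℝ => (Iio t).indicator (fun y => φ y ^ 2 *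
        ENNReal.ofReal (y ^ b)) y * ENNReal.ofReal (t ^ (σ - 1 - b))) := by
    have : (Function.uncurry fun t y : ℝ => (Iio t).indicator (fun y => φ y ^ 2 *
        ENNReal.ofReal (y ^ b)) y * ENNReal.ofReal (t ^ (σ - 1 - b))) =
        fun p : ℝ × ℝ => {p : ℝ × ℝ | p.2 < p.1}.indicator (fun p => φ p.2 ^ 2 *
        ENNReal.ofReal (p.2 ^ b)) p * ENNReal.ofReal (p.1 ^ (σ - 1 - b)) := by
      ext p; simp [Function.uncurry, indicator]
    rw [this]
    refine Measurable.mul (Measurable.indicator (by fun_prop)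
      (measurableSet_lt measurable_snd measurable_fst)) (by fun_prop)
  rw [lintegral_lintegral_swap hmeas.aemeasurable,
    ← lintegral_const_mul' _ _ ENNReal.ofReal_ne_top]
  refine setLIntegral_mono' measurableSet_Ioo fun y hy => ?_
  have hy0 := hy.1
  calc _ = (φ y ^ 2 * ENNReal.ofReal (y ^ b)) *
        ∫⁻ t in Ioo 0 T, (Ioi y).indicator (fun t => ENNReal.ofReal (t ^ (σ - 1 - b))) t := by
        rw [← lintegral_const_mul _ (Measurable.indicator (by fun_prop) measurableSet_Ioi)]
        refine lintegral_congr fun t => ?_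
        simp only [indicator, mem_Iio, mem_Ioi]
        split_ifs <;> simp
    _ ≤ (φ y ^ 2 * ENNReal.ofReal (y ^ b)) * ∫⁻ t in Ioi y, ENNReal.ofReal (t ^ (σ - 1 - b)) := by
        refine mul_le_mul_right ?_ _
        rw [setLIntegral_indicator measurableSet_Ioi]
        exact lintegral_mono_set inter_subset_left
    _ = _ := by
        rw [setLIntegral_Ioi_rpow (by linarith) hy0, mul_assoc, mul_left_comm (ENNReal.ofReal _)]
        congr 1
        rw [← ENNReal.ofReal_mul (by positivity), ← ENNReal.ofReal_mul (by positivity)]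
        congr 1
        rw [mul_div_assoc', ← Real.rpow_add hy0, show -(σ - 1 - b + 1) = b - σ by ring,
          show b + (σ - 1 - b + 1) = σ by ring]
        ring

/-! ### Campanato's theorem: `BMO^β` consists of Hölder functions -/

lemma Arc.len_pos (I : Arc) : 0 < I.len :=
  div_pos (sub_pos.2 I.left_lt_right) (by positivity)

lemma Arc.right_sub_left (I : Arc) : I.right - I.left = 2 * Real.pi * I.len := by
  rw [Arc.len]; field_simp

lemma Arc.len_le_one (I : Arc) : I.len ≤ 1 := by
  rw [Arc.len, div_le_one (by positivity)]
  linarith [I.right_le]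

/-- The arc with the angles `(x - π t, x + π t)`, of normalized length `t`. -/
noncomputable def Arc.centered (x t : ℝ) (h0 : 0 < t) (h1 : t ≤ 1) : Arc where
  left := x - Real.pi * t
  right := x + Real.pi * t
  left_lt_right := by have := mul_pos Real.pi_pos h0; linarith
  right_le := by nlinarith [Real.pi_pos]

@[simp] lemma Arc.len_centered (x t : ℝ) (h0 : 0 < t) (h1 : t ≤ 1) :
    (Arc.centered x t h0 h1).len = t := by
  simp only [Arc.centered, Arc.len]; field_simp; ring

lemma le_mul_ofReal_rpow {x q : ℝ} (hx : 0 < x) {X C : ENNReal}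
    (h : ENNReal.ofReal (x ^ (-q)) * X ≤ C) : X ≤ C * ENNReal.ofReal (x ^ q) := by
  calc X = ENNReal.ofReal (x ^ (-q)) * X * ENNReal.ofReal (x ^ q) := by
        rw [mul_right_comm, ← ENNReal.ofReal_mul (by positivity), ← Real.rpow_add hx]
        simp
    _ ≤ _ := by gcongr

lemma periodic_comp_exp {X : Type*} (f : Circle → X) :
    Function.Periodic (fun s : ℝ => f (Circle.exp s)) (2 * Real.pi) := fun s => by
  simp only [Circle.periodic_exp s]

lemma MemL2.intervalIntegrable {f : Circle → ℂ} (hf : MemL2 f) (a b : ℝ) :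
    IntervalIntegrable (fun s : ℝ => f (Circle.exp s)) volume a b := by
  refine (periodic_comp_exp f).intervalIntegrable (by positivity) (t := 0) ?_ a b
  rw [intervalIntegrable_iff_integrableOn_Ioc_of_le (by positivity), zero_add]
  exact hf.integrable (by norm_num)

lemma MemL2.integrableOn {f : Circle → ℂ} (hf : MemL2 f) (a b : ℝ) :
    IntegrableOn (fun s : ℝ => f (Circle.exp s)) (Ioo a b) := by
  rcases le_total a b with h | h
  · exact ((intervalIntegrable_iff_integrableOn_Ioo_of_le h).1 (hf.intervalIntegrable a b))
  · simp [Ioo_eq_empty_of_le h]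

lemma MemL2.locallyIntegrable {f : Circle → ℂ} (hf : MemL2 f) :
    LocallyIntegrable (fun s : ℝ => f (Circle.exp s)) := fun x =>
  ⟨Ioo (x - 1) (x + 1), Ioo_mem_nhds (by linarith) (by linarith), hf.integrableOn _ _⟩

lemma MemBMO.exists_integral_norm_sub_mean_le {β : ℝ} {f : Circle → ℂ} (hf : MemBMO β f) :
    ∃ M : ℝ, 0 ≤ M ∧ ∀ I : Arc,
      ∫ s in I.angles, ‖f (Circle.exp s) - I.mean f‖ ≤ M * I.len ^ (3 - 2 * β) := by
  obtain ⟨hf2, hB⟩ := hf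
  set B := bmoSeminormSq β f
  refine ⟨Real.sqrt (2 * Real.pi * B.toReal), Real.sqrt_nonneg _, fun I => ?_⟩
  have hlen := I.len_pos
  have hint : IntegrableOn (fun s : ℝ => f (Circle.exp s) - I.mean f) I.angles :=
    (hf2.integrableOn _ _).sub (integrable_const _)
  have h1 : ∫⁻ s in I.angles, ENNReal.ofReal (‖f (Circle.exp s) - I.mean f‖ ^ 2) ≤
      B * ENNReal.ofReal (I.len ^ (5 - 4 * β)) := by
    refine le_mul_ofReal_rpow hlen ?_
    rw [neg_sub]
    exact le_iSup (fun I : Arc => ENNReal.ofReal (I.len ^ (4 * β - 5)) *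
      ∫⁻ s in I.angles, ENNReal.ofReal (‖f (Circle.exp s) - I.mean f‖ ^ 2)) I
  have cs := sq_lintegral_mul_le (μ := volume.restrict I.angles)
    (φ := fun s => ENNReal.ofReal ‖f (Circle.exp s) - I.mean f‖)
    (w := fun _ => 1) (u := fun _ => 1) (v := fun _ => 1)
    hint.1.norm.aemeasurable.ennreal_ofReal measurable_const measurable_const (by simp)
  simp only [mul_one, lintegral_const, one_mul, Measure.restrict_apply MeasurableSet.univ,
    univ_inter] at cs
  rw [← ofReal_integral_eq_lintegral_ofReal hint.norm (ae_of_all _ fun _ => norm_nonneg _)] at cs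
  simp only [← ENNReal.ofReal_pow (norm_nonneg _)] at cs
  have h2 := cs.trans (mul_le_mul_left h1 _)
  have hnn : 0 ≤ ∫ s in I.angles, ‖f (Circle.exp s) - I.mean f‖ :=
    integral_nonneg fun _ => norm_nonneg _
  have hvol : volume I.angles = ENNReal.ofReal (I.right - I.left) := Real.volume_Ioo
  rw [← ENNReal.ofReal_toReal hB.ne, hvol, I.right_sub_left,
    ← ENNReal.ofReal_mul ENNReal.toReal_nonneg,
    ← ENNReal.ofReal_mul (by positivity), ← ENNReal.ofReal_pow hnn,
    ENNReal.ofReal_le_ofReal_iff (by positivity)] at h2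
  refine abs_le_of_sq_le_sq' (h2.trans_eq ?_) (by positivity) |>.2
  rw [mul_pow, Real.sq_sqrt (by positivity), ← Real.rpow_mul_natCast hlen.le,
    show (3 - 2 * β) * (2 : ℕ) = (5 - 4 * β) + 1 by push_cast; ring, Real.rpow_add_one hlen.ne']
  ring

/-- The mean over a subinterval of at least a quarter of an arc differs little from the mean over
the arc. -/
lemma MemBMO.exists_norm_average_sub_mean_le {β : ℝ} {f : Circle → ℂ} (hf : MemBMO β f) :
    ∃ M : ℝ, 0 ≤ M ∧ ∀ (I : Arc) (c d : ℝ), I.left ≤ c → d ≤ I.right →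
      (I.right - I.left) / 4 ≤ d - c →
      ‖(⨍ s in Ioo c d, f (Circle.exp s)) - I.mean f‖ ≤ M * I.len ^ (2 - 2 * β) := by
  obtain ⟨M, hM, h⟩ := hf.exists_integral_norm_sub_mean_le
  refine ⟨M, hM, fun I c d hc hd hcd => ?_⟩
  have hlen := I.len_pos
  have hIL := I.left_lt_right
  have hcd0 : 0 < d - c := by linarith
  have hi := hf.1.integrableOn c d
  have hvol : volume.real (Ioo c d) = d - c := by
    rw [Measure.real, Real.volume_Ioo, ENNReal.toReal_ofReal hcd0.le]
  have heq : (⨍ s in Ioo c d, f (Circle.exp s)) - I.mean f =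
      (d - c)⁻¹ • ∫ s in Ioo c d, (f (Circle.exp s) - I.mean f) := by
    rw [integral_sub hi (integrable_const _), smul_sub, setAverage_eq, hvol, setIntegral_const,
      hvol, smul_smul, inv_mul_cancel₀ hcd0.ne', one_smul]
  have hint : IntegrableOn (fun s : ℝ => f (Circle.exp s) - I.mean f) I.angles :=
    (hf.1.integrableOn _ _).sub (integrable_const _)
  calc _ ≤ (d - c)⁻¹ * ∫ s in Ioo c d, ‖f (Circle.exp s) - I.mean f‖ := by
        rw [heq, norm_smul, norm_inv, Real.norm_of_nonneg hcd0.le]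
        gcongr
        exact norm_integral_le_integral_norm _
    _ ≤ (d - c)⁻¹ * ∫ s in I.angles, ‖f (Circle.exp s) - I.mean f‖ := by
        refine mul_le_mul_of_nonneg_left ?_ (by positivity)
        exact setIntegral_mono_set hint.norm (ae_of_all _ fun _ => norm_nonneg _)
          (Ioo_subset_Ioo hc hd).eventuallyLE
    _ ≤ I.len⁻¹ * (M * I.len ^ (3 - 2 * β)) := by
        gcongr
        · rw [I.right_sub_left] at hcd
          nlinarith [Real.pi_gt_three]
        · exact h I
    _ = _ := by
        rw [show 3 - 2 * β = (2 - 2 * β) + 1 by ring, Real.rpow_add_one hlen.ne']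
        field_simp

/-- Every `f ∈ BMO^β` agrees almost everywhere with a Hölder function of order `2 - 2β`: the means
of `f` over the arcs centred at a point form a Cauchy sequence with geometric rate, and by
Lebesgue's differentiation theorem their limit is almost everywhere `f`. -/
theorem MemBMO.exists_holder {β : ℝ} (hβ1 : β < 1) {f : Circle → ℂ} (hf : MemBMO β f) :
    ∃ (g : ℝ → ℂ) (M : ℝ), 0 ≤ M ∧ Function.Periodic g (2 * Real.pi) ∧
      (∀ x y, ‖g x - g y‖ ≤ M * |x - y| ^ (2 - 2 * β)) ∧
      (fun s : ℝ => f (Circle.exp s)) =ᵐ[volume] g := by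
  obtain ⟨M, hM, h⟩ := hf.exists_norm_average_sub_mean_le
  set α := 2 - 2 * β with hα
  have hα0 : 0 < α := by rw [hα]; linarith
  have hπ := Real.pi_pos
  have ht0 : ∀ n : ℕ, (0 : ℝ) < (1 / 2) ^ n := fun n => by positivity
  have ht1 : ∀ n : ℕ, ((1 : ℝ) / 2) ^ n ≤ 1 := fun n => pow_le_one₀ (by norm_num) (by norm_num)
  set J : ℕ → ℝ → Arc := fun n x => Arc.centered x ((1 / 2) ^ n) (ht0 n) (ht1 n) with hJ
  set ρ : ℝ := (1 / 2) ^ α with hρ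
  have hρ1 : ρ < 1 := Real.rpow_lt_one (by norm_num) (by norm_num) hα0
  have hpow : ∀ n : ℕ, ((1 / 2 : ℝ) ^ n) ^ α = ρ ^ n := fun n => by
    rw [hρ, ← Real.rpow_natCast, ← Real.rpow_natCast, ← Real.rpow_mul (by norm_num),
      ← Real.rpow_mul (by norm_num), mul_comm]
  have hJlen : ∀ n x, (J n x).len ^ α = ρ ^ n := fun n x => by
    rw [hJ, Arc.len_centered, hpow]
  have hstep : ∀ x n, dist ((J n x).mean f) ((J (n + 1) x).mean f) ≤ M * ρ ^ n := by
    intro x n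
    rw [dist_comm, dist_eq_norm, ← hJlen n x]
    have := mul_pos hπ (ht0 n)
    refine h (J n x) _ _ ?_ ?_ ?_ <;> simp only [hJ, Arc.centered, pow_succ] <;> linarith
  have hlim : ∀ x, ∃ a, Tendsto (fun n => (J n x).mean f) atTop (𝓝 a) := fun x =>
    cauchySeq_tendsto_of_complete (cauchySeq_of_le_geometric ρ M hρ1 (hstep x))
  choose g hg using hlim
  have hdist : ∀ x n, ‖(J n x).mean f - g x‖ ≤ M * ρ ^ n / (1 - ρ) := fun x n => by
    rw [← dist_eq_norm]
    exact dist_le_of_le_geometric_of_tendsto ρ M hρ1 (hstep x) (hg x) n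
  have hper : Function.Periodic g (2 * Real.pi) := by
    intro x
    refine tendsto_nhds_unique (hg (x + 2 * Real.pi)) ((hg x).congr fun n => ?_)
    have e : ∀ y, (J n y).mean f =
        ((J n x).right - (J n x).left)⁻¹ • ∫ s in
          (y - Real.pi * (1 / 2) ^ n)..(y + Real.pi * (1 / 2) ^ n), f (Circle.exp s) := by
      intro y
      have := mul_pos hπ (ht0 n)
      rw [Arc.mean, setAverage_eq, intervalIntegral.integral_of_le (by linarith),
        integral_Ioc_eq_integral_Ioo]
      congr 2
      simp only [Arc.angles, Measure.real, Real.volume_Ioo]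
      rw [ENNReal.toReal_ofReal (by simp only [hJ, Arc.centered]; linarith)]
      simp only [hJ, Arc.centered]; ring
    rw [e, e]
    congr 1
    have := intervalIntegral.integral_comp_add_right (fun s => f (Circle.exp s))
      (a := x - Real.pi * (1 / 2) ^ n) (b := x + Real.pi * (1 / 2) ^ n) (2 * Real.pi)
    simp only [Circle.periodic_exp _] at this
    rw [this]
    congr 1 <;> ring
  set M' := M * (2 / (1 - ρ) + 2) with hM'
  have hM'0 : 0 ≤ M' := by positivity
  -- points at distance less than `π`, where the two arcs of comparable length share a third one
  have hnear : ∀ x y, x < y → y - x ≤ Real.pi → ‖g x - g y‖ ≤ M' * (y - x) ^ α := by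
    intro x y hxy hπ'
    obtain ⟨n, hn1, hn2⟩ := exists_nat_pow_near_of_lt_one (x := (y - x) / Real.pi)
      (y := (1 / 2 : ℝ)) (by positivity) ((div_le_one hπ).2 hπ') (by norm_num) (by norm_num)
    rw [div_le_iff₀ hπ] at hn2
    rw [pow_succ, lt_div_iff₀ hπ] at hn1
    have hx := h (J n x) x (x + Real.pi * (1 / 2) ^ n)
      (by simp only [hJ, Arc.centered]; linarith)
      (by simp only [hJ, Arc.centered]; linarith) (by simp only [hJ, Arc.centered]; linarith)
    have hy := h (J n y) x (x + Real.pi * (1 / 2) ^ n)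
      (by simp only [hJ, Arc.centered]; linarith)
      (by simp only [hJ, Arc.centered]; linarith) (by simp only [hJ, Arc.centered]; linarith)
    rw [hJlen] at hx hy
    have hx' := hdist x n
    have hy' := hdist y n
    have hρn : ρ ^ n ≤ (y - x) ^ α := by
      rw [← hpow]
      refine Real.rpow_le_rpow (by positivity) ?_ hα0.le
      nlinarith [Real.pi_gt_three, ht0 n]
    set m := ⨍ s in Ioo x (x + Real.pi * (1 / 2) ^ n), f (Circle.exp s)
    calc ‖g x - g y‖ = ‖-((J n x).mean f - g x) - (m - (J n x).mean f) + (m - (J n y).mean f)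
          + ((J n y).mean f - g y)‖ := by congr 1; ring
      _ ≤ M * ρ ^ n / (1 - ρ) + M * ρ ^ n + M * ρ ^ n + M * ρ ^ n / (1 - ρ) := by
          refine (norm_add_le _ _).trans (add_le_add ((norm_add_le _ _).trans
            (add_le_add ((norm_sub_le _ _).trans (add_le_add ?_ hx)) hy)) hy')
          rwa [norm_neg]
      _ = M' * ρ ^ n := by rw [hM']; ring
      _ ≤ _ := by gcongr
  have hnear' : ∀ x y, |x - y| ≤ Real.pi → ‖g x - g y‖ ≤ M' * |x - y| ^ α := by
    intro x y hxy
    rcases lt_trichotomy x y with hlt | rfl | hlt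
    · rw [abs_sub_comm, abs_of_pos (by linarith)] at hxy ⊢
      exact hnear x y hlt hxy
    · simp [Real.zero_rpow hα0.ne']
    · rw [norm_sub_rev]
      rw [abs_of_pos (by linarith)] at hxy ⊢
      exact hnear y x hlt hxy
  refine ⟨g, M', hM'0, hper, fun x y => ?_, ?_⟩
  · rcases le_or_gt |x - y| Real.pi with hle | hgt
    · exact hnear' x y hle
    · -- replace `y` by its nearest translate to `x`
      set k := round ((x - y) / (2 * Real.pi)) with hk
      have hk' : |x - (y + k * (2 * Real.pi))| ≤ Real.pi := by
        have := abs_sub_round ((x - y) / (2 * Real.pi))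
        have e : x - (y + k * (2 * Real.pi)) =
            (2 * Real.pi) * ((x - y) / (2 * Real.pi) - round ((x - y) / (2 * Real.pi))) := by
          rw [← hk]; field_simp; ring
        rw [e, abs_mul, abs_of_pos (by positivity)]
        nlinarith
      have hgk : g (y + k * (2 * Real.pi)) = g y := hper.int_mul k y
      rw [← hgk]
      refine (hnear' _ _ hk').trans ?_
      exact mul_le_mul_of_nonneg_left
        (Real.rpow_le_rpow (abs_nonneg _) (hk'.trans hgt.le) hα0.le) hM'0
  · filter_upwards [IsUnifLocDoublingMeasure.ae_tendsto_average volume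
      hf.1.locallyIntegrable 1] with x hx
    have hδ : Tendsto (fun n : ℕ => Real.pi * (1 / 2 : ℝ) ^ n) atTop (𝓝[>] 0) := by
      refine tendsto_nhdsWithin_iff.2 ⟨?_, Eventually.of_forall fun n => mul_pos hπ (ht0 n)⟩
      simpa using (tendsto_pow_atTop_nhds_zero_of_lt_one (r := (1 / 2 : ℝ)) (by norm_num)
        (by norm_num)).const_mul Real.pi
    have := hx (fun _ => x) _ hδ (Eventually.of_forall fun n => by
      simpa using (mul_pos hπ (ht0 n)).le)
    refine tendsto_nhds_unique this ((hg x).congr fun n => ?_)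
    rw [Arc.mean, Real.closedBall_eq_Icc]
    simp only [Arc.angles, hJ, Arc.centered]
    rw [setAverage_eq, setAverage_eq, Measure.real, Measure.real, Real.volume_Ioo,
      Real.volume_Icc, integral_Icc_eq_integral_Ioo]

/-! ### Families of quantities indexed by arcs -/

/-- `X(I) ≤ C |I|^q` for all arcs `I`, with a finite constant `C`. -/
def ArcBound (q : ℝ) (X : Arc → ENNReal) : Prop :=
  ∃ C : ENNReal, C ≠ ⊤ ∧ ∀ I : Arc, X I ≤ C * ENNReal.ofReal (I.len ^ q)

lemma ArcBound.mono {q : ℝ} {X Y : Arc → ENNReal} (hY : ArcBound q Y) {c : ENNReal} (hc : c ≠ ⊤)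
    (h : ∀ I, X I ≤ c * Y I) : ArcBound q X := by
  obtain ⟨C, hC, hYC⟩ := hY
  refine ⟨c * C, by finiteness, fun I => (h I).trans ?_⟩
  rw [mul_assoc]
  gcongr
  exact hYC I

lemma ArcBound.add {q : ℝ} {X Y : Arc → ENNReal} (hX : ArcBound q X) (hY : ArcBound q Y) :
    ArcBound q fun I => X I + Y I := by
  obtain ⟨C, hC, hXC⟩ := hX
  obtain ⟨D, hD, hYD⟩ := hY
  exact ⟨C + D, by finiteness, fun I => (add_le_add (hXC I) (hYD I)).trans_eq (add_mul _ _ _).symm⟩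

lemma iSup_ofReal_rpow_mul_lt_top_iff {q : ℝ} {X : Arc → ENNReal} :
    (⨆ I : Arc, ENNReal.ofReal (I.len ^ (-q)) * X I) < ⊤ ↔ ArcBound q X := by
  constructor
  · intro h
    exact ⟨_, h.ne, fun I => le_mul_ofReal_rpow I.len_pos
      (le_iSup (fun I : Arc => ENNReal.ofReal (I.len ^ (-q)) * X I) I)⟩
  · rintro ⟨C, hC, h⟩
    refine (iSup_le fun I => ?_).trans_lt hC.lt_top
    have := I.len_pos
    calc _ ≤ ENNReal.ofReal (I.len ^ (-q)) * (C * ENNReal.ofReal (I.len ^ q)) := by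
          gcongr; exact h I
      _ = C := by
          rw [mul_left_comm, ← ENNReal.ofReal_mul (by positivity), ← Real.rpow_add I.len_pos]
          simp

/-- The arc `I` rotated by the angle `c`. -/
def Arc.rotate (I : Arc) (c : ℝ) : Arc where
  left := I.left + c
  right := I.right + c
  left_lt_right := by linarith [I.left_lt_right]
  right_le := by linarith [I.right_le]

@[simp] lemma Arc.len_rotate (I : Arc) (c : ℝ) : (I.rotate c).len = I.len := by
  simp [Arc.rotate, Arc.len]

lemma ArcBound.comp_rotate {q : ℝ} {X : Arc → ENNReal} (hX : ArcBound q X) (c : Arc → ℝ) :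
    ArcBound q fun I => X (I.rotate (c I)) := by
  obtain ⟨C, hC, h⟩ := hX
  exact ⟨C, hC, fun I => by simpa using h (I.rotate (c I))⟩

/-! ### Translations, halves and periods -/

lemma setLIntegral_Ioo_comp_add (h : ℝ → ENNReal) (a b c : ℝ) :
    ∫⁻ t in Ioo a b, h (c + t) = ∫⁻ u in Ioo (c + a) (c + b), h u := by
  have := (measurePreserving_add_left volume c).setLIntegral_comp_emb
    (measurableEmbedding_addLeft c) h (Ioo a b)
  rwa [image_const_add_Ioo] at this

lemma setLIntegral_Ioo_comp_sub (h : ℝ → ENNReal) (a b c : ℝ) :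
    ∫⁻ t in Ioo a b, h (c - t) = ∫⁻ u in Ioo (c - b) (c - a), h u := by
  have := (Measure.measurePreserving_sub_left volume c).setLIntegral_comp_emb
    (measurableEmbedding_subLeft c) h (Ioo a b)
  rwa [image_const_sub_Ioo] at this

lemma setLIntegral_Ioo_le_add (h : ℝ → ENNReal) (a m b : ℝ) :
    ∫⁻ t in Ioo a b, h t ≤ (∫⁻ t in Ioo a m, h t) + ∫⁻ t in Ioo m b, h t := by
  rw [setLIntegral_congr (Ioo_ae_eq_Ioc (a := a) (b := m))]
  refine (lintegral_mono_set fun t ht => ?_).trans (lintegral_union_le h (Ioc a m) (Ioo m b))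
  rcases le_or_gt t m with hm | hm
  · exact Or.inl ⟨ht.1, hm⟩
  · exact Or.inr ⟨hm, ht.2⟩

lemma setLIntegral_Ioo_period {h : ℝ → ENNReal} {T : ℝ} (hT : 0 < T)
    (hh : Function.Periodic h T) (a b : ℝ) :
    ∫⁻ t in Ioo a (a + T), h t = ∫⁻ t in Ioo b (b + T), h t := by
  rw [setLIntegral_congr Ioo_ae_eq_Ioc, setLIntegral_congr Ioo_ae_eq_Ioc]
  exact (isAddFundamentalDomain_Ioc hT a).setLIntegral_eq (isAddFundamentalDomain_Ioc hT b) h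
    hh.map_vadd_zmultiples

/-- Both halves of an arc `I` stay inside a rotate of `I` when moved by at most a quarter of the
angle of `I`. -/
lemma setLIntegral_angles_le_of_halves {h : ℝ → ENNReal} (I : Arc) {X : Arc → ENNReal}
    (hX : ∀ (J : Arc) (c d : ℝ), J.len = I.len → J.left ≤ c - (I.right - I.left) / 4 →
      d + (I.right - I.left) / 4 ≤ J.right → c < d → d - c = (I.right - I.left) / 2 →
      ∫⁻ s in Ioo c d, h s ≤ X J) :
    ∫⁻ s in I.angles, h s ≤ X (I.rotate (-((I.right - I.left) / 4))) +
      X (I.rotate ((I.right - I.left) / 4)) := by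
  have := I.left_lt_right
  refine (setLIntegral_Ioo_le_add h _ ((I.left + I.right) / 2) _).trans (add_le_add ?_ ?_) <;>
  · refine hX _ _ _ (Arc.len_rotate _ _) ?_ ?_ (by linarith) (by linarith) <;>
    · simp only [Arc.rotate]; linarith

/-- For a symmetric integrand the triangle `s < u` carries half of the double integral. -/
lemma setLIntegral_symm_le {K : ℝ → ℝ → ENNReal} (hK : Measurable (Function.uncurry K))
    (hs : ∀ s u, K s u = K u s) (a b : ℝ) :
    ∫⁻ s in Ioo a b, ∫⁻ u in Ioo a b, K s u ≤ 2 * ∫⁻ s in Ioo a b, ∫⁻ u in Ioo s b, K s u := by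
  have hm : Measurable (Function.uncurry fun s u : ℝ => (Iio s).indicator (fun u => K s u) u) := by
    have : (Function.uncurry fun s u : ℝ => (Iio s).indicator (fun u => K s u) u) =
        {p : ℝ × ℝ | p.2 < p.1}.indicator (Function.uncurry K) := by
      ext p; simp [Function.uncurry, indicator]
    rw [this]
    exact hK.indicator (measurableSet_lt measurable_snd measurable_fst)
  have hsplit : ∀ s ∈ Ioo a b, ∫⁻ u in Ioo a b, K s u ≤
      (∫⁻ u in Ioo a b, (Iio s).indicator (fun u => K s u) u) + ∫⁻ u in Ioo s b, K s u := by
    intro s hs'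
    refine (setLIntegral_Ioo_le_add _ a s b).trans (add_le_add_left ?_ _)
    rw [setLIntegral_indicator measurableSet_Iio]
    exact lintegral_mono_set fun u hu => ⟨hu.2, hu.1, hu.2.trans hs'.2⟩
  refine (setLIntegral_mono' measurableSet_Ioo hsplit).trans ?_
  have hm' : Measurable fun s => ∫⁻ u in Ioo a b, (Iio s).indicator (fun u => K s u) u :=
    hm.lintegral_prod_right'
  rw [lintegral_add_left hm', two_mul]
  refine add_le_add_left ?_ _
  rw [lintegral_lintegral_swap hm.aemeasurable]
  refine setLIntegral_mono' measurableSet_Ioo fun u hu => ?_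
  calc _ = ∫⁻ s in Ioo a b, (Ioi u).indicator (fun s => K u s) s := by
        refine lintegral_congr fun s => ?_
        simp only [indicator, mem_Iio, mem_Ioi, hs s u]
    _ ≤ _ := by
        rw [setLIntegral_indicator measurableSet_Ioi]
        exact lintegral_mono_set fun s hs => ⟨hs.1, hs.2.2⟩

/-! ### Periodic Hölder functions and the three double integrals -/

/-- `g` is `2π`-periodic and Hölder continuous of order `α` with constant `M`. -/
structure PeriodicHolder (α M : ℝ) (g : ℝ → ℂ) : Prop where
  nonneg : 0 ≤ M
  periodic : Function.Periodic g (2 * Real.pi)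
  norm_sub_le : ∀ x y, ‖g x - g y‖ ≤ M * |x - y| ^ α

lemma PeriodicHolder.continuous {α M : ℝ} {g : ℝ → ℂ} (hg : PeriodicHolder α M g) (hα : 0 < α) :
    Continuous g := by
  rw [continuous_iff_continuousAt]
  intro x
  rw [ContinuousAt, tendsto_iff_norm_sub_tendsto_zero]
  refine squeeze_zero (fun _ => norm_nonneg _) (fun y => hg.norm_sub_le y x) ?_
  have : ContinuousAt (fun y : ℝ => M * |y - x| ^ α) x := by
    refine continuousAt_const.mul (ContinuousAt.rpow_const (by fun_prop) (Or.inr hα.le))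
  simpa [ContinuousAt, Real.zero_rpow hα.ne'] using this

/-- The integrand `|g(s) - g(u)|² / |s - u|^{2-σ}`. -/
noncomputable def diffKernel (σ : ℝ) (g : ℝ → ℂ) (s u : ℝ) : ENNReal :=
  ENNReal.ofReal (‖g s - g u‖ ^ 2 * |s - u| ^ (σ - 2))

/-- The same integrand with the distance `|e^{is} - e^{iu}|` in place of `|s - u|`. -/
noncomputable def chordKernel (σ : ℝ) (g : ℝ → ℂ) (s u : ℝ) : ENNReal :=
  ENNReal.ofReal (‖g s - g u‖ ^ 2 / ‖(Circle.exp s : ℂ) - (Circle.exp u : ℂ)‖ ^ (2 - σ))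

/-- The double integral of `diffKernel` over an arc. -/
noncomputable def diffEnergy (σ : ℝ) (g : ℝ → ℂ) (I : Arc) : ENNReal :=
  ∫⁻ s in I.angles, ∫⁻ u in I.angles, diffKernel σ g s u

/-- The double integral of `chordKernel` over an arc. -/
noncomputable def chordEnergy (σ : ℝ) (g : ℝ → ℂ) (I : Arc) : ENNReal :=
  ∫⁻ s in I.angles, ∫⁻ u in I.angles, chordKernel σ g s u

/-- The integral of `|g(s+t) - g(s)|² / t^{2-σ}` over `s` in the angles of `I` and `0 < t < |I|`;
here `s + t` may lie outside `I`. -/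
noncomputable def shiftEnergy (σ : ℝ) (g : ℝ → ℂ) (I : Arc) : ENNReal :=
  ∫⁻ s in I.angles, ∫⁻ t in Ioo 0 I.len, diffKernel σ g s (s + t)

lemma measurable_diffKernel {g : ℝ → ℂ} (hg : Continuous g) (σ : ℝ) :
    Measurable (Function.uncurry (diffKernel σ g)) := by
  have := hg.measurable
  unfold diffKernel Function.uncurry
  fun_prop

lemma measurable_diffKernel_add {g : ℝ → ℂ} (hg : Continuous g) (σ : ℝ) :
    Measurable (Function.uncurry fun s t : ℝ => diffKernel σ g s (s + t)) := by
  have := hg.measurable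
  unfold diffKernel Function.uncurry
  fun_prop

lemma diffKernel_comm (σ : ℝ) (g : ℝ → ℂ) (s u : ℝ) :
    diffKernel σ g s u = diffKernel σ g u s := by
  rw [diffKernel, diffKernel, norm_sub_rev, abs_sub_comm]

lemma norm_exp_sub_exp (s u : ℝ) :
    ‖(Circle.exp s : ℂ) - (Circle.exp u : ℂ)‖ = 2 * |Real.sin ((s - u) / 2)| := by
  have h : (Circle.exp s : ℂ) - (Circle.exp u : ℂ) =
      Circle.exp u * (Complex.exp (Complex.I * ((s - u : ℝ) : ℂ)) - 1) := by
    rw [Circle.coe_exp, Circle.coe_exp, mul_sub, ← Complex.exp_add, mul_one]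
    congr 2
    push_cast; ring
  rw [h, norm_mul, Circle.norm_coe, one_mul, Complex.norm_exp_I_mul_ofReal_sub_one, norm_mul,
    Real.norm_eq_abs, Real.norm_eq_abs, abs_of_pos (by norm_num : (0 : ℝ) < 2)]

lemma norm_exp_sub_exp_le (s u : ℝ) :
    ‖(Circle.exp s : ℂ) - (Circle.exp u : ℂ)‖ ≤ |s - u| := by
  rw [norm_exp_sub_exp]
  have := Real.abs_sin_le_abs (x := (s - u) / 2)
  rw [abs_div, abs_two] at this
  linarith

lemma le_norm_exp_sub_exp {s u : ℝ} (h : |s - u| ≤ Real.pi) :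
    2 / Real.pi * |s - u| ≤ ‖(Circle.exp s : ℂ) - (Circle.exp u : ℂ)‖ := by
  rw [norm_exp_sub_exp]
  have := Real.mul_abs_le_abs_sin (x := (s - u) / 2) (by rw [abs_div, abs_two]; linarith)
  rw [abs_div, abs_two] at this
  linarith

lemma diffKernel_le_chordKernel {σ : ℝ} (hσ : σ < 1) (g : ℝ → ℂ) {s u : ℝ}
    (h : |s - u| < 2 * Real.pi) : diffKernel σ g s u ≤ chordKernel σ g s u := by
  rcases eq_or_ne s u with rfl | hne
  · simp [diffKernel]
  have hc : 0 < ‖(Circle.exp s : ℂ) - (Circle.exp u : ℂ)‖ := by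
    rw [norm_exp_sub_exp]
    refine mul_pos two_pos (abs_pos.2 fun h0 => ?_)
    rw [Real.sin_eq_zero_iff_of_lt_of_lt] at h0
    · exact hne (by linarith)
    · have := (abs_lt.1 h).1; linarith
    · have := (abs_lt.1 h).2; linarith
  apply ENNReal.ofReal_le_ofReal
  rw [div_eq_mul_inv, ← Real.rpow_neg hc.le, neg_sub]
  gcongr ?_ * ?_
  exact Real.rpow_le_rpow_of_nonpos hc (norm_exp_sub_exp_le s u) (by linarith)

lemma chordKernel_le_diffKernel {σ : ℝ} (hσ : σ < 1) (g : ℝ → ℂ) {s u : ℝ}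
    (h : |s - u| ≤ Real.pi) :
    chordKernel σ g s u ≤ ENNReal.ofReal ((2 / Real.pi) ^ (σ - 2)) * diffKernel σ g s u := by
  rcases eq_or_ne s u with rfl | hne
  · simp [chordKernel]
  have hc := le_norm_exp_sub_exp h
  have hc0 : 0 < 2 / Real.pi * |s - u| := by positivity
  rw [diffKernel, ← ENNReal.ofReal_mul (by positivity)]
  apply ENNReal.ofReal_le_ofReal
  rw [div_eq_mul_inv, ← Real.rpow_neg (by positivity), neg_sub, mul_left_comm,
    ← Real.mul_rpow (by positivity) (by positivity)]
  gcongr ?_ * ?_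
  exact Real.rpow_le_rpow_of_nonpos hc0 hc (by linarith)

lemma Arc.abs_sub_lt (I : Arc) {s u : ℝ} (hs : s ∈ I.angles) (hu : u ∈ I.angles) :
    |s - u| < I.right - I.left := by
  rw [abs_lt]
  constructor <;> linarith [hs.1, hs.2, hu.1, hu.2]

lemma diffEnergy_le_chordEnergy {σ : ℝ} (hσ : σ < 1) (g : ℝ → ℂ) (I : Arc) :
    diffEnergy σ g I ≤ chordEnergy σ g I := by
  refine setLIntegral_mono' measurableSet_Ioo fun s hs => ?_
  refine setLIntegral_mono' measurableSet_Ioo fun u hu => ?_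
  exact diffKernel_le_chordKernel hσ g ((I.abs_sub_lt hs hu).trans_le (by linarith [I.right_le]))

lemma setLIntegral_comp_add_le_diffEnergy {σ : ℝ} (g : ℝ → ℂ) (J : Arc) {c d δ : ℝ}
    (hc : J.left ≤ c) (hd : d + δ ≤ J.right) (hδ : 0 ≤ δ) :
    ∫⁻ s in Ioo c d, ∫⁻ t in Ioo 0 δ, diffKernel σ g s (s + t) ≤ diffEnergy σ g J := by
  refine (setLIntegral_mono' measurableSet_Ioo fun s hs => ?_).trans
    (lintegral_mono_set (Ioo_subset_Ioo hc (by linarith)))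
  rw [setLIntegral_Ioo_comp_add (fun u => diffKernel σ g s u)]
  exact lintegral_mono_set (Ioo_subset_Ioo (by linarith [hs.1]) (by linarith [hs.2]))

lemma setLIntegral_comp_sub_le_diffEnergy {σ : ℝ} (g : ℝ → ℂ) (J : Arc) {c d δ : ℝ}
    (hc : J.left ≤ c - δ) (hd : d ≤ J.right) (hδ : 0 ≤ δ) :
    ∫⁻ s in Ioo c d, ∫⁻ t in Ioo 0 δ, diffKernel σ g s (s - t) ≤ diffEnergy σ g J := by
  refine (setLIntegral_mono' measurableSet_Ioo fun s hs => ?_).trans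
    (lintegral_mono_set (Ioo_subset_Ioo (by linarith) hd))
  rw [setLIntegral_Ioo_comp_sub (fun u => diffKernel σ g s u)]
  exact lintegral_mono_set (Ioo_subset_Ioo (by linarith [hs.1]) (by linarith [hs.2]))

/-- `|I|` is at most a quarter `(π / 2) |I|` of the angle of `I`, so that translating a half of `I`
by `t < |I|` does not leave the rotated arc. -/
lemma ArcBound.shiftEnergy_of_diffEnergy {σ q : ℝ} {g : ℝ → ℂ}
    (h : ArcBound q (diffEnergy σ g)) : ArcBound q (shiftEnergy σ g) := by
  refine ((h.comp_rotate fun I => -((I.right - I.left) / 4)).add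
    (h.comp_rotate fun I => (I.right - I.left) / 4)).mono ENNReal.one_ne_top fun I => ?_
  rw [one_mul]
  refine setLIntegral_angles_le_of_halves I (X := diffEnergy σ g) fun J c d _ hc hd _ _ => ?_
  have hl := I.right_sub_left
  refine (lintegral_mono fun s => lintegral_mono_set (Ioo_subset_Ioo le_rfl ?_)).trans
    (setLIntegral_comp_add_le_diffEnergy g J (δ := (I.right - I.left) / 4) ?_ hd ?_)
  · nlinarith [Real.pi_gt_three]
  · linarith
  · linarith

lemma PeriodicHolder.diffKernel_le {α M σ : ℝ} {g : ℝ → ℂ} (hg : PeriodicHolder α M g)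
    (s u : ℝ) : diffKernel σ g s u ≤
      ENNReal.ofReal (M ^ 2 * (|s - u| ^ α) ^ 2 * |s - u| ^ (σ - 2)) := by
  refine ENNReal.ofReal_le_ofReal ?_
  rw [← mul_pow]
  gcongr
  exact hg.norm_sub_le s u

/-- Pairs of points of an arc `I` whose distance is comparable to `|I|` contribute at most
`C |I|^{σ+2α}` to the energies of a Hölder function. -/
lemma PeriodicHolder.diffKernel_le_of_le {α M σ : ℝ} {g : ℝ → ℂ} (hg : PeriodicHolder α M g)
    (hα : 0 < α) (hσ : σ < 1) {c C l s u : ℝ} (hc : 0 < c) (hC : 0 ≤ C) (hl : 0 < l)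
    (h1 : c * l ≤ |s - u|) (h2 : |s - u| ≤ C * l) :
    diffKernel σ g s u ≤
      ENNReal.ofReal (M ^ 2 * (C ^ α) ^ 2 * c ^ (σ - 2) * l ^ (σ + 2 * α - 2)) := by
  refine (hg.diffKernel_le s u).trans (ENNReal.ofReal_le_ofReal ?_)
  calc _ ≤ M ^ 2 * ((C * l) ^ α) ^ 2 * (c * l) ^ (σ - 2) := by
        gcongr ?_ * ?_
        · gcongr
        · exact Real.rpow_le_rpow_of_nonpos (by positivity) h1 (by linarith)
    _ = _ := by
        rw [Real.mul_rpow hC hl.le, Real.mul_rpow hc.le hl.le,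
          show σ + 2 * α - 2 = α + α + (σ - 2) by ring, Real.rpow_add hl, Real.rpow_add hl]
        ring

/-- By symmetry `s < u` may be assumed. The pairs with `u - s ≥ |I|` are covered by
`diffKernel_le_of_le`. -/
lemma ArcBound.diffEnergy_of_shiftEnergy {α M σ : ℝ} {g : ℝ → ℂ} (hg : PeriodicHolder α M g)
    (hα : 0 < α) (hσ : σ < 1) (h : ArcBound (σ + 2 * α) (shiftEnergy σ g)) :
    ArcBound (σ + 2 * α) (diffEnergy σ g) := by
  set A : ℝ := M ^ 2 * ((2 * Real.pi) ^ α) ^ 2 * 1 ^ (σ - 2)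
  have hfar : ArcBound (σ + 2 * α) fun I => ∫⁻ s in I.angles, ∫⁻ u in I.angles,
      ENNReal.ofReal (A * I.len ^ (σ + 2 * α - 2)) := by
    refine ⟨ENNReal.ofReal (A * (2 * Real.pi) ^ 2), by finiteness, fun I => le_of_eq ?_⟩
    have hlen := I.len_pos
    simp only [lintegral_const, Measure.restrict_apply MeasurableSet.univ, univ_inter, Arc.angles,
      Real.volume_Ioo, I.right_sub_left]
    rw [← ENNReal.ofReal_mul (by positivity), ← ENNReal.ofReal_mul (by positivity),
      ← ENNReal.ofReal_mul (by positivity)]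
    congr 1
    rw [show σ + 2 * α = (σ + 2 * α - 2) + (2 : ℕ) by push_cast; ring,
      Real.rpow_add_natCast hlen.ne']
    push_cast
    ring_nf
  refine (h.add hfar).mono ENNReal.ofNat_ne_top (c := 2) fun I => ?_
  refine (setLIntegral_symm_le (measurable_diffKernel (hg.continuous hα) σ)
    (diffKernel_comm σ g) _ _).trans ?_
  gcongr
  have hlen := I.len_pos
  have hIL := I.right_sub_left
  rw [shiftEnergy, ← lintegral_add_right _ (by fun_prop)]
  refine setLIntegral_mono' measurableSet_Ioo fun s hs => ?_
  refine (setLIntegral_Ioo_le_add _ s (s + I.len) _).trans (add_le_add ?_ ?_)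
  · rw [setLIntegral_Ioo_comp_add (fun u => diffKernel σ g s u), add_zero]
  · refine (setLIntegral_mono' measurableSet_Ioo fun u hu => ?_).trans
      (lintegral_mono_set (Ioo_subset_Ioo (by linarith [hs.1]) le_rfl))
    have : |s - u| = u - s := by rw [abs_sub_comm, abs_of_pos (by linarith [hu.1])]
    exact hg.diffKernel_le_of_le hα hσ one_pos (by positivity) hlen
      (by rw [this]; linarith [hu.1]) (by rw [this]; linarith [hu.2, hs.1])

lemma chordKernel_periodic {α M : ℝ} {g : ℝ → ℂ} (hg : PeriodicHolder α M g) (σ s : ℝ) :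
    Function.Periodic (chordKernel σ g s) (2 * Real.pi) := fun u => by
  simp only [chordKernel, hg.periodic u, Circle.periodic_exp u]

/-- For arcs shorter than half a turn the two kernels are comparable. A longer arc is replaced by
the full circle, where the variable `u` is moved to `(s - π, s + π)` by periodicity, and `s` is
restricted to a half circle. -/
lemma ArcBound.chordEnergy_of_diffEnergy {α M σ : ℝ} {g : ℝ → ℂ} (hg : PeriodicHolder α M g)
    (hα : 0 < α) (hσ0 : 0 < σ) (hσ : σ < 1) (h : ArcBound (σ + 2 * α) (diffEnergy σ g)) :
    ArcBound (σ + 2 * α) (chordEnergy σ g) := by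
  obtain ⟨C, hC, hCI⟩ := h
  have hπ := Real.pi_gt_three
  set B : ENNReal := ENNReal.ofReal ((2 / Real.pi) ^ (σ - 2))
  set D : ENNReal :=
    ENNReal.ofReal (M ^ 2 * (Real.pi ^ α) ^ 2 * 1 ^ (σ - 2) * 1 ^ (σ + 2 * α - 2))
  have hBtop : B ≠ ⊤ := ENNReal.ofReal_ne_top
  set V : ENNReal := ENNReal.ofReal (2 * Real.pi) with hV
  have hhalf : ∀ c : ℝ, ∫⁻ s in Ioo c (c + Real.pi),
      ∫⁻ u in Ioo (s - Real.pi) (s - Real.pi + 2 * Real.pi), chordKernel σ g s u ≤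
      B * (C + D * V * V) := by
    intro c
    -- this arc contains all points at distance less than `1` from `(c, c + π)`
    set J : Arc := ⟨c - 1, c + Real.pi + 1, by linarith, by linarith⟩ with hJ
    have hpt : ∀ s ∈ Ioo c (c + Real.pi),
        ∀ u ∈ Ioo (s - Real.pi) (s - Real.pi + 2 * Real.pi),
        chordKernel σ g s u ≤ B * (J.angles.indicator (fun u => diffKernel σ g s u) u + D) := by
      intro s hs u hu
      have hsu : |s - u| ≤ Real.pi := by
        rw [abs_le]; constructor <;> linarith [hu.1, hu.2]
      refine (chordKernel_le_diffKernel hσ g hsu).trans ?_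
      gcongr
      by_cases huJ : u ∈ J.angles
      · rw [indicator_of_mem huJ]; exact le_self_add
      · rw [indicator_of_notMem huJ, zero_add]
        refine hg.diffKernel_le_of_le hα hσ one_pos Real.pi_pos.le one_pos ?_ (by linarith)
        rw [one_mul]
        by_contra! hlt
        rw [abs_lt] at hlt
        exact huJ ⟨by simp only [hJ]; linarith [hs.1], by simp only [hJ]; linarith [hs.2]⟩
    have hmeas : ∀ s, Measurable (fun u => J.angles.indicator (fun u => diffKernel σ g s u) u) :=
      fun s => ((measurable_diffKernel (hg.continuous hα) σ).comp measurable_prodMk_left).indicator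
        measurableSet_Ioo
    have hm2 : Measurable fun s => ∫⁻ u in J.angles, diffKernel σ g s u :=
      (measurable_diffKernel (hg.continuous hα) σ).lintegral_prod_right'
    calc _ ≤ ∫⁻ s in Ioo c (c + Real.pi), B * ((∫⁻ u in J.angles, diffKernel σ g s u) + D * V) := by
          refine setLIntegral_mono' measurableSet_Ioo fun s hs => ?_
          refine (setLIntegral_mono' measurableSet_Ioo (hpt s hs)).trans ?_
          rw [lintegral_const_mul' _ _ hBtop, lintegral_add_left (hmeas s)]
          refine mul_le_mul_right (add_le_add ?_ ?_) _
          · rw [Arc.angles, setLIntegral_indicator measurableSet_Ioo]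
            exact lintegral_mono_set inter_subset_left
          · simp [hV]
      _ ≤ _ := by
          rw [lintegral_const_mul' _ _ hBtop, lintegral_add_left hm2]
          refine mul_le_mul_right (add_le_add ?_ ?_) _
          · refine (lintegral_mono_set ?_).trans ((hCI J).trans ?_)
            · exact Ioo_subset_Ioo (by simp only [hJ]; linarith) (by simp only [hJ]; linarith)
            · refine mul_le_of_le_one_right zero_le ?_
              rw [ENNReal.ofReal_le_one]
              exact Real.rpow_le_one J.len_pos.le J.len_le_one (by linarith)
          · simp only [lintegral_const, Measure.restrict_apply MeasurableSet.univ, univ_inter,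
              Real.volume_Ioo]
            exact mul_le_mul_right (ENNReal.ofReal_le_ofReal (by linarith)) _
  have hfull : ∀ a : ℝ, ∫⁻ s in Ioo a (a + 2 * Real.pi), ∫⁻ u in Ioo a (a + 2 * Real.pi),
      chordKernel σ g s u ≤ 2 * (B * (C + D * V * V)) := by
    intro a
    calc _ = ∫⁻ s in Ioo a (a + 2 * Real.pi),
          ∫⁻ u in Ioo (s - Real.pi) (s - Real.pi + 2 * Real.pi), chordKernel σ g s u :=
          lintegral_congr fun s => setLIntegral_Ioo_period (by positivity)
            (chordKernel_periodic hg σ s) _ _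
      _ ≤ _ := by
          refine (setLIntegral_Ioo_le_add _ a (a + Real.pi) _).trans ?_
          rw [two_mul (B * _)]
          refine add_le_add (hhalf a) ?_
          rw [show a + 2 * Real.pi = a + Real.pi + Real.pi by ring]
          exact hhalf _
  refine ⟨B * C + 2 * (B * (C + D * V * V)) * ENNReal.ofReal (2 ^ (σ + 2 * α)), by finiteness,
    fun I => ?_⟩
  have hlen := I.len_pos
  rcases le_or_gt I.len (1 / 2) with hle | hgt
  · rw [add_mul]
    refine le_add_right ?_
    rw [mul_assoc]
    refine le_trans ?_ (mul_le_mul_right (hCI I) B)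
    rw [diffEnergy, ← lintegral_const_mul' _ _ hBtop]
    refine setLIntegral_mono' measurableSet_Ioo fun s hs => ?_
    rw [← lintegral_const_mul' _ _ hBtop]
    refine setLIntegral_mono' measurableSet_Ioo fun u hu => ?_
    refine chordKernel_le_diffKernel hσ g ((I.abs_sub_lt hs hu).le.trans ?_)
    rw [I.right_sub_left]
    nlinarith
  · rw [add_mul]
    refine le_add_left ?_
    have hsub : I.angles ⊆ Ioo I.left (I.left + 2 * Real.pi) := Ioo_subset_Ioo le_rfl I.right_le
    refine ((lintegral_mono fun s => lintegral_mono_set hsub).trans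
      ((lintegral_mono_set hsub).trans (hfull I.left))).trans ?_
    rw [mul_assoc _ (ENNReal.ofReal (2 ^ _))]
    refine le_mul_of_one_le_right zero_le ?_
    rw [← ENNReal.ofReal_mul (by positivity), ENNReal.one_le_ofReal,
      ← Real.mul_rpow (by norm_num) hlen.le]
    exact Real.one_le_rpow (by linarith) (by linarith)

/-! ### Passage from `f` to its Hölder representative -/

lemma memQ_iff_arcBound {p β : ℝ} {f : Circle → ℂ} {g : ℝ → ℂ} (hf : MemL2 f)
    (hfg : (fun s : ℝ => f (Circle.exp s)) =ᵐ[volume] g) :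
    MemQ p β f ↔ ArcBound (p + 2 - 2 * β) (chordEnergy (p - 2 + 2 * β) g) := by
  have hE : ∀ I : Arc, (∫⁻ t in I.angles, ∫⁻ s in I.angles,
      ENNReal.ofReal (‖f (Circle.exp s) - f (Circle.exp t)‖ ^ 2 /
        ‖(Circle.exp s : ℂ) - (Circle.exp t : ℂ)‖ ^ (4 - p - 2 * β))) =
      chordEnergy (p - 2 + 2 * β) g I := by
    intro I
    refine lintegral_congr_ae (ae_restrict_of_ae (hfg.mono fun t ht => ?_))
    refine lintegral_congr_ae (ae_restrict_of_ae (hfg.mono fun s hs => ?_))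
    simp only [chordKernel, hs, ht]
    rw [norm_sub_rev (g s), norm_sub_rev (Circle.exp s : ℂ),
      show 4 - p - 2 * β = 2 - (p - 2 + 2 * β) by ring]
  rw [MemQ, and_iff_right hf, qSeminorm, ← iSup_ofReal_rpow_mul_lt_top_iff]
  simp only [hE]
  rw [show 2 * β - 2 - p = -(p + 2 - 2 * β) by ring]
  have h := (ENNReal.orderIsoRpow (1 / 2 : ℝ) (by norm_num)).map_iSup
    fun I : Arc => ENNReal.ofReal (I.len ^ (-(p + 2 - 2 * β))) * chordEnergy (p - 2 + 2 * β) g I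
  simp only [ENNReal.orderIsoRpow_apply] at h
  rw [← h, ENNReal.rpow_lt_top_iff_of_pos (by norm_num)]

lemma translationSup_lt_top_iff_arcBound {p β : ℝ} {f : Circle → ℂ} {g : ℝ → ℂ}
    (hg : Continuous g) (hfg : (fun s : ℝ => f (Circle.exp s)) =ᵐ[volume] g) :
    translationSup p β f < ⊤ ↔ ArcBound (p + 2 - 2 * β) (shiftEnergy (p - 2 + 2 * β) g) := by
  have hE : ∀ I : Arc, (∫⁻ t in Ioo 0 I.len,
      (∫⁻ s in I.angles, ENNReal.ofReal (‖f (Circle.exp (s + t)) - f (Circle.exp s)‖ ^ 2)) /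
        ENNReal.ofReal (t ^ (4 - p - 2 * β))) = shiftEnergy (p - 2 + 2 * β) g I := by
    intro I
    rw [shiftEnergy, lintegral_lintegral_swap
      (measurable_diffKernel_add hg (p - 2 + 2 * β)).aemeasurable]
    refine setLIntegral_congr_fun measurableSet_Ioo fun t ht => ?_
    have ht0 := ht.1
    rw [ENNReal.div_eq_inv_mul, ← ENNReal.ofReal_inv_of_pos (by positivity),
      ← lintegral_const_mul' _ _ ENNReal.ofReal_ne_top]
    have hshift : ∀ᵐ s : ℝ, f (Circle.exp (s + t)) = g (s + t) :=
      (measurePreserving_add_right volume t).quasiMeasurePreserving.ae hfg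
    refine lintegral_congr_ae (ae_restrict_of_ae ?_)
    filter_upwards [hfg, hshift] with s hs hst
    rw [hs, hst, ← ENNReal.ofReal_mul (by positivity), diffKernel, norm_sub_rev (g s),
      show s - (s + t) = -t by ring, abs_neg, abs_of_pos ht0, ← Real.rpow_neg ht0.le, mul_comm]
    congr 3; ring
  rw [translationSup, ← iSup_ofReal_rpow_mul_lt_top_iff]
  simp only [hE]
  rw [show 2 * β - p - 2 = -(p + 2 - 2 * β) by ring]

/-- The function on the unit circle (extended to `ℂ` by means of the argument) with the values
`g(s)` at `e^{is}`. -/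
noncomputable def boundaryFun (g : ℝ → ℂ) (z : ℂ) : ℂ := g z.arg

lemma boundaryFun_circleMap {g : ℝ → ℂ} (hg : Function.Periodic g (2 * Real.pi)) (s : ℝ) :
    boundaryFun g (circleMap 0 1 s) = g s := by
  have h : Circle.exp (circleMap 0 1 s).arg = Circle.exp s := by
    have : circleMap 0 1 s = (Circle.exp s : ℂ) := by simp [circleMap]
    rw [this, Circle.exp_arg]
  obtain ⟨m, hm⟩ := Circle.exp_eq_exp.1 h
  rw [boundaryFun, hm]
  exact hg.int_mul m s

/-- The Poisson integral of a function on the unit circle, as an average over the circle. -/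
noncomputable def poissonAverage (G : ℂ → ℂ) (z : ℂ) : ℂ :=
  Real.circleAverage (fun ζ => poissonKernel 0 z ζ • G ζ) 0 1

lemma poissonIntegral_eq_poissonAverage {f : Circle → ℂ} {g : ℝ → ℂ}
    (hg : Function.Periodic g (2 * Real.pi))
    (hfg : (fun s : ℝ => f (Circle.exp s)) =ᵐ[volume] g) :
    poissonIntegral f = poissonAverage (boundaryFun g) := by
  ext z
  rw [poissonIntegral, poissonAverage, Real.circleAverage_def,
    intervalIntegral.integral_of_le (by positivity), one_div]
  congr 1
  refine integral_congr_ae (ae_restrict_of_ae (hfg.mono fun s hs => ?_))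
  have hexp : circleMap 0 1 s = (Circle.exp s : ℂ) := by simp [circleMap]
  beta_reduce
  rw [boundaryFun_circleMap hg, hexp]
  exact congrArg (poissonKernel 0 z (Circle.exp s : ℂ) • ·) hs

/-! ### Derivatives of Poisson integrals -/

/-- The kernel `2ζ / (ζ - z)²` is the complex derivative in `z` of the Herglotz kernel
`(ζ + z) / (ζ - z)`, whose real part is the Poisson kernel; this is its average against `G`. -/
noncomputable def herglotzDeriv (G : ℂ → ℂ) (z : ℂ) : ℂ :=
  Real.circleAverage (fun ζ => (2 * ζ / (ζ - z) ^ 2) • G ζ) 0 1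

lemma circleIntegrable_conj {G : ℂ → ℂ} (hG : CircleIntegrable G 0 1) :
    CircleIntegrable (fun ζ => starRingEnd ℂ (G ζ)) 0 1 := by
  simp only [CircleIntegrable, intervalIntegrable_iff] at hG ⊢
  exact Complex.conjCLE.toContinuousLinearMap.integrable_comp hG

lemma circleIntegrable_herglotzRieszKernel_smul {G : ℂ → ℂ} (hG : CircleIntegrable G 0 1) {z : ℂ}
    (hz : z ∈ Metric.ball (0 : ℂ) 1) :
    CircleIntegrable (fun ζ => herglotzRieszKernel 0 z ζ • G ζ) 0 1 :=
  hG.continuousOn_smul (continuousOn_herglotzRieszKernel_sphere hz)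

lemma poissonAverage_eq {G : ℂ → ℂ} (hG : CircleIntegrable G 0 1) {z : ℂ}
    (hz : z ∈ Metric.ball (0 : ℂ) 1) :
    poissonAverage G z =
      (Real.circleAverage (fun ζ => herglotzRieszKernel 0 z ζ • G ζ) 0 1 +
        starRingEnd ℂ (Real.circleAverage
          (fun ζ => herglotzRieszKernel 0 z ζ • starRingEnd ℂ (G ζ)) 0 1)) / 2 := by
  have h1 := circleIntegrable_herglotzRieszKernel_smul hG hz
  have h2 := circleIntegrable_herglotzRieszKernel_smul (circleIntegrable_conj hG) hz
  have h3 : starRingEnd ℂ (Real.circleAverage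
      (fun ζ => herglotzRieszKernel 0 z ζ • starRingEnd ℂ (G ζ)) 0 1) =
      Real.circleAverage (fun ζ => starRingEnd ℂ
        (herglotzRieszKernel 0 z ζ • starRingEnd ℂ (G ζ))) 0 1 :=
    (Complex.conjCLE.toContinuousLinearMap.circleAverage_comp_comm h2).symm
  rw [h3, ← Real.circleAverage_fun_add h1 (circleIntegrable_conj h2), poissonAverage,
    poissonKernel_eq_re_herglotzRieszKernel, div_eq_inv_mul, ← smul_eq_mul,
    ← Real.circleAverage_fun_smul]
  congr 1
  ext ζ
  simp only [Function.comp_apply, smul_eq_mul, map_mul, Complex.conj_conj, Complex.real_smul,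
    Complex.re_eq_add_conj]
  ring

/-- The real derivative of a Poisson integral. -/
lemma hasFDerivAt_poissonAverage {G : ℂ → ℂ} (hG : CircleIntegrable G 0 1) {z : ℂ}
    (hz : z ∈ Metric.ball (0 : ℂ) 1) :
    ∃ L : ℂ →L[ℝ] ℂ, HasFDerivAt (poissonAverage G) L z ∧ ∀ v, L v =
      (v * herglotzDeriv G z +
        starRingEnd ℂ (v * herglotzDeriv (fun ζ => starRingEnd ℂ (G ζ)) z)) / 2 := by
  have h1 := (hasDerivAt_circleAverage_herglotzRieszKernel_smul hG hz).hasFDerivAt.restrictScalars ℝ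
  have h2 := (hasDerivAt_circleAverage_herglotzRieszKernel_smul
    (circleIntegrable_conj hG) hz).hasFDerivAt.restrictScalars ℝ
  have h3 := (h1.add (Complex.conjCLE.toContinuousLinearMap.hasFDerivAt.comp z h2)).const_smul
    (2⁻¹ : ℂ)
  refine ⟨_, h3.congr_of_eventuallyEq ?_, fun v => ?_⟩
  · filter_upwards [Metric.isOpen_ball.mem_nhds hz] with w hw
    rw [poissonAverage_eq hG hw]
    simp [div_eq_inv_mul]
  · simp [herglotzDeriv, div_eq_inv_mul]
    ring

lemma gradSq_poissonAverage {G : ℂ → ℂ} (hG : CircleIntegrable G 0 1) {z : ℂ}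
    (hz : z ∈ Metric.ball (0 : ℂ) 1) :
    gradSq (poissonAverage G) z = ‖herglotzDeriv G z‖ ^ 2 +
      ‖herglotzDeriv (fun ζ => starRingEnd ℂ (G ζ)) z‖ ^ 2 := by
  obtain ⟨L, hL, hLv⟩ := hasFDerivAt_poissonAverage hG hz
  have h1 : 2 * dz (poissonAverage G) z = herglotzDeriv G z := by
    rw [dz, hL.fderiv, hLv, hLv]
    simp only [map_mul, Complex.conj_I, map_one]
    linear_combination (-(1 / 2 : ℂ) * herglotzDeriv G z + (1 / 2 : ℂ) *
      starRingEnd ℂ (herglotzDeriv (fun ζ => starRingEnd ℂ (G ζ)) z)) * Complex.I_sq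
  have h2 : 2 * dzbar (poissonAverage G) z =
      starRingEnd ℂ (herglotzDeriv (fun ζ => starRingEnd ℂ (G ζ)) z) := by
    rw [dzbar, hL.fderiv, hLv, hLv]
    simp only [map_mul, Complex.conj_I, map_one]
    linear_combination ((1 / 2 : ℂ) * herglotzDeriv G z - (1 / 2 : ℂ) *
      starRingEnd ℂ (herglotzDeriv (fun ζ => starRingEnd ℂ (G ζ)) z)) * Complex.I_sq
  rw [gradSq, h1, h2, RCLike.norm_conj]

lemma continuousOn_herglotzDeriv {G : ℂ → ℂ} (hG : CircleIntegrable G 0 1) :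
    ContinuousOn (herglotzDeriv G) (Metric.ball 0 1) := by
  have h := (analyticOnNhd_circleAverage_herglotzRieszKernel_smul hG).deriv.continuousOn
  refine h.congr fun z hz => ?_
  exact (hasDerivAt_circleAverage_herglotzRieszKernel_smul hG hz).deriv.symm

/-- The increment of a Poisson integral along a path of speed at most one. -/
lemma enorm_poissonAverage_sub_le {G : ℂ → ℂ} (hG : CircleIntegrable G 0 1) {γ γ' : ℝ → ℂ}
    (hγ : ∀ t, HasDerivAt γ (γ' t) t) (hγ' : Continuous γ') {a b : ℝ} (hab : a ≤ b)
    (hb : ∀ t ∈ Icc a b, γ t ∈ Metric.ball (0 : ℂ) 1) (hn : ∀ t, ‖γ' t‖ ≤ 1) :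
    ‖poissonAverage G (γ b) - poissonAverage G (γ a)‖ₑ ≤
      ∫⁻ t in Ioo a b, ENNReal.ofReal (Real.sqrt (gradSq (poissonAverage G) (γ t))) := by
  set D := herglotzDeriv G with hD
  set D' := herglotzDeriv (fun ζ => starRingEnd ℂ (G ζ)) with hD'
  have hγc : Continuous γ := continuous_iff_continuousAt.2 fun t => (hγ t).continuousAt
  have hder : ∀ t ∈ uIcc a b, HasDerivAt (fun t => poissonAverage G (γ t))
      ((γ' t * D (γ t) + starRingEnd ℂ (γ' t * D' (γ t))) / 2) t := by
    intro t ht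
    rw [uIcc_of_le hab] at ht
    obtain ⟨L, hL, hLv⟩ := hasFDerivAt_poissonAverage hG (hb t ht)
    rw [← hLv]
    exact hL.comp_hasDerivAt t (hγ t)
  have hcD : ContinuousOn (fun t => D (γ t)) (Icc a b) :=
    (continuousOn_herglotzDeriv hG).comp hγc.continuousOn hb
  have hcD' : ContinuousOn (fun t => D' (γ t)) (Icc a b) :=
    (continuousOn_herglotzDeriv (circleIntegrable_conj hG)).comp hγc.continuousOn hb
  have hcont : ContinuousOn
      (fun t => (γ' t * D (γ t) + starRingEnd ℂ (γ' t * D' (γ t))) / 2) (Icc a b) := by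
    refine ContinuousOn.div_const ((hγ'.continuousOn.mul hcD).add ?_) _
    exact Complex.continuous_conj.comp_continuousOn (hγ'.continuousOn.mul hcD')
  have hint : IntervalIntegrable
      (fun t => (γ' t * D (γ t) + starRingEnd ℂ (γ' t * D' (γ t))) / 2) volume a b :=
    (hcont.mono (by rw [uIcc_of_le hab])).intervalIntegrable
  rw [← intervalIntegral.integral_eq_sub_of_hasDerivAt hder hint,
    intervalIntegral.integral_of_le hab, integral_Ioc_eq_integral_Ioo]
  refine (enorm_integral_le_lintegral_enorm _).trans ?_
  refine setLIntegral_mono' measurableSet_Ioo fun t ht => ?_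
  rw [← ofReal_norm]
  apply ENNReal.ofReal_le_ofReal
  apply Real.le_sqrt_of_sq_le
  rw [gradSq_poissonAverage hG (hb t (Ioo_subset_Icc_self ht)), ← hD, ← hD']
  have h1 : ‖(γ' t * D (γ t) + starRingEnd ℂ (γ' t * D' (γ t))) / 2‖ ≤
      (‖D (γ t)‖ + ‖D' (γ t)‖) / 2 := by
    rw [norm_div, Complex.norm_two]
    gcongr
    refine (norm_add_le _ _).trans ?_
    rw [RCLike.norm_conj, norm_mul, norm_mul]
    exact add_le_add (mul_le_of_le_one_left (norm_nonneg _) (hn t))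
      (mul_le_of_le_one_left (norm_nonneg _) (hn t))
  refine (pow_le_pow_left₀ (norm_nonneg _) h1 2).trans ?_
  nlinarith [sq_nonneg (‖D (γ t)‖ - ‖D' (γ t)‖), sq_nonneg ‖D (γ t)‖, sq_nonneg ‖D' (γ t)‖]

/-! ### Kernel estimates near the circle -/

/-- The point `(1 - y) e^{iθ}` at distance `y` from the circle. -/
noncomputable def polarPoint (y θ : ℝ) : ℂ := (1 - y : ℝ) * Complex.exp (θ * Complex.I)

lemma norm_polarPoint {y : ℝ} (hy : y ≤ 1) (θ : ℝ) : ‖polarPoint y θ‖ = 1 - y := by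
  rw [polarPoint, norm_mul, Complex.norm_exp_ofReal_mul_I, mul_one, Complex.norm_real,
    Real.norm_of_nonneg (by linarith)]

lemma polarPoint_mem_ball {y : ℝ} (h0 : 0 < y) (h1 : y ≤ 1) (θ : ℝ) :
    polarPoint y θ ∈ Metric.ball (0 : ℂ) 1 := by
  rw [mem_ball_zero_iff, norm_polarPoint h1]; linarith

/-- The distance from `e^{is}` to `(1 - y) e^{iθ}` is at least comparable to `y` and to the angle. -/
lemma sq_add_sq_le_norm_sub_polarPoint {y : ℝ} (h0 : 0 < y) (h1 : y ≤ 1) {s θ : ℝ}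
    (h : |s - θ| ≤ Real.pi) :
    (y ^ 2 + (s - θ) ^ 2) / (1 + Real.pi ^ 2) ≤ ‖circleMap 0 1 s - polarPoint y θ‖ ^ 2 := by
  have hπ := Real.pi_pos
  set N := ‖circleMap 0 1 s - polarPoint y θ‖ with hN
  have hy : y ≤ N := by
    have := norm_sub_norm_le (circleMap 0 1 s) (polarPoint y θ)
    rw [norm_polarPoint h1, norm_circleMap_zero, abs_one] at this
    linarith
  have hc := le_norm_exp_sub_exp h
  have ht : |s - θ| ≤ Real.pi * N := by
    have e : (Circle.exp s : ℂ) - (Circle.exp θ : ℂ) =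
        (circleMap 0 1 s - polarPoint y θ) - y * Complex.exp (θ * Complex.I) := by
      simp only [Circle.coe_exp, circleMap, polarPoint]; push_cast; ring
    rw [e] at hc
    have := hc.trans (norm_sub_le _ _)
    rw [norm_mul, Complex.norm_exp_ofReal_mul_I, mul_one, Complex.norm_real,
      Real.norm_of_nonneg h0.le, ← hN] at this
    have h2 : 2 / Real.pi * |s - θ| ≤ 2 * N := by linarith
    rw [div_mul_eq_mul_div, div_le_iff₀ hπ] at h2
    linarith
  rw [div_le_iff₀ (by positivity)]
  have h3 : (s - θ) ^ 2 ≤ (Real.pi * N) ^ 2 := by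
    rw [← sq_abs]; gcongr
  nlinarith [pow_le_pow_left₀ h0.le hy 2]

/-- The differences of `g` between `θ` and the two points at distance `t`. -/
noncomputable def twoSidedDiff (g : ℝ → ℂ) (θ t : ℝ) : ENNReal :=
  ‖g (θ + t) - g θ‖ₑ + ‖g (θ - t) - g θ‖ₑ

lemma circleIntegrable_boundaryFun {g : ℝ → ℂ} (hg : Continuous g)
    (hper : Function.Periodic g (2 * Real.pi)) : CircleIntegrable (boundaryFun g) 0 1 := by
  rw [CircleIntegrable]
  simp only [boundaryFun_circleMap hper]
  exact hg.intervalIntegrable _ _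

/-- A circle average against a kernel dominated by `1 / (y² + t²)`, where `t` is the angle from
the point `e^{iθ}`. -/
lemma enorm_circleAverage_le {g : ℝ → ℂ} (hg : Continuous g)
    (hper : Function.Periodic g (2 * Real.pi))
    {k G : ℂ → ℂ} {A y θ : ℝ} (hA : 0 ≤ A)
    (hG : ∀ s, ‖G (circleMap 0 1 s)‖ₑ ≤ ‖g s - g θ‖ₑ)
    (hk : ∀ s, |s - θ| ≤ Real.pi → ‖k (circleMap 0 1 s)‖ ≤ A * (y ^ 2 + (s - θ) ^ 2)⁻¹) :
    ‖Real.circleAverage (fun ζ => k ζ • G ζ) 0 1‖ₑ ≤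
      ENNReal.ofReal A * ∫⁻ t in Ioo 0 Real.pi,
        twoSidedDiff g θ t * ENNReal.ofReal (y ^ 2 + t ^ 2)⁻¹ := by
  have hπ := Real.pi_gt_three
  set h : ℝ → ENNReal := fun s => ‖k (circleMap 0 1 s)‖ₑ * ‖g s - g θ‖ₑ with hh
  have hhper : Function.Periodic h (2 * Real.pi) := fun s => by
    simp only [hh, hper s, periodic_circleMap 0 1 s]
  have hk' : ∀ s, |s - θ| ≤ Real.pi →
      h s ≤ ENNReal.ofReal A * (‖g s - g θ‖ₑ * ENNReal.ofReal (y ^ 2 + (s - θ) ^ 2)⁻¹) := by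
    intro s hs
    simp only [hh]
    rw [mul_left_comm, ← ENNReal.ofReal_mul hA, mul_comm]
    gcongr
    rw [← ofReal_norm]
    exact ENNReal.ofReal_le_ofReal (hk s hs)
  have h1 : ‖Real.circleAverage (fun ζ => k ζ • G ζ) 0 1‖ₑ ≤
      ∫⁻ s in Ioo 0 (0 + 2 * Real.pi), h s := by
    rw [Real.circleAverage_def, enorm_smul, intervalIntegral.integral_of_le (by positivity),
      integral_Ioc_eq_integral_Ioo, zero_add]
    refine mul_le_of_le_one_of_le ?_ ((enorm_integral_le_lintegral_enorm _).trans ?_)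
    · rw [← ofReal_norm, ENNReal.ofReal_le_one, norm_inv, Real.norm_of_nonneg (by positivity)]
      exact inv_le_one_of_one_le₀ (by linarith)
    · refine lintegral_mono fun s => ?_
      rw [enorm_smul]
      exact mul_le_mul_right (hG s) _
  refine h1.trans ?_
  rw [setLIntegral_Ioo_period (by positivity) hhper 0 (θ - Real.pi)]
  have e1 := setLIntegral_Ioo_comp_add h 0 Real.pi θ
  have e2 := setLIntegral_Ioo_comp_sub h 0 Real.pi θ
  rw [add_zero] at e1
  rw [sub_zero] at e2
  refine (setLIntegral_Ioo_le_add _ _ θ _).trans ?_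
  rw [show θ - Real.pi + 2 * Real.pi = θ + Real.pi by ring, ← e1, ← e2,
    ← lintegral_const_mul' _ _ ENNReal.ofReal_ne_top]
  have hgm := hg.measurable
  calc _ ≤ (∫⁻ t in Ioo 0 Real.pi, ENNReal.ofReal A *
          (‖g (θ - t) - g θ‖ₑ * ENNReal.ofReal (y ^ 2 + t ^ 2)⁻¹)) +
        ∫⁻ t in Ioo 0 Real.pi, ENNReal.ofReal A *
          (‖g (θ + t) - g θ‖ₑ * ENNReal.ofReal (y ^ 2 + t ^ 2)⁻¹) := by
        refine add_le_add (setLIntegral_mono' measurableSet_Ioo fun t ht => ?_)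
          (setLIntegral_mono' measurableSet_Ioo fun t ht => ?_)
        · have := hk' (θ - t) (by
            rw [show θ - t - θ = -t by ring, abs_neg, abs_of_pos ht.1]; exact ht.2.le)
          rwa [show (θ - t - θ) ^ 2 = t ^ 2 by ring] at this
        · have := hk' (θ + t) (by
            rw [show θ + t - θ = t by ring, abs_of_pos ht.1]; exact ht.2.le)
          rwa [show (θ + t - θ) ^ 2 = t ^ 2 by ring] at this
    _ = _ := by
        rw [← lintegral_add_left (by fun_prop)]
        refine lintegral_congr fun t => ?_
        rw [twoSidedDiff]; ring

lemma poissonAverage_const (c : ℂ) {z : ℂ} (hz : z ∈ Metric.ball (0 : ℂ) 1) :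
    poissonAverage (fun _ => c) z = c :=
  (diffContOnCl_const (c := c)).circleAverage_poissonKernel_smul hz

/-- The Poisson integral of a constant is that constant, so that its gradient vanishes. -/
lemma herglotzDeriv_const (c : ℂ) {z : ℂ} (hz : z ∈ Metric.ball (0 : ℂ) 1) :
    herglotzDeriv (fun _ => c) z = 0 := by
  have h := gradSq_poissonAverage (circleIntegrable_const c 0 1) hz
  have h0 : fderiv ℝ (poissonAverage fun _ => c) z = 0 := by
    have : poissonAverage (fun _ => c) =ᶠ[𝓝 z] fun _ => c := by
      filter_upwards [Metric.isOpen_ball.mem_nhds hz] with w hw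
      exact poissonAverage_const c hw
    rw [this.fderiv_eq, fderiv_fun_const]; rfl
  rw [gradSq, dz, dzbar, h0] at h
  simp only [zero_apply, mul_zero, sub_zero, add_zero, zero_div, norm_zero,
    ne_eq, OfNat.ofNat_ne_zero, not_false_eq_true, zero_pow] at h
  have : ‖herglotzDeriv (fun _ => c) z‖ ^ 2 = 0 := by
    nlinarith [sq_nonneg (‖herglotzDeriv (fun _ => c) z‖),
      sq_nonneg (‖herglotzDeriv (fun _ => (starRingEnd ℂ) c) z‖)]
  simpa using this

lemma herglotzDeriv_sub_const {G : ℂ → ℂ} (hG : CircleIntegrable G 0 1) (c : ℂ) {z : ℂ}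
    (hz : z ∈ Metric.ball (0 : ℂ) 1) :
    herglotzDeriv G z = Real.circleAverage (fun ζ => (2 * ζ / (ζ - z) ^ 2) • (G ζ - c)) 0 1 := by
  have hk : ContinuousOn (fun ζ : ℂ => 2 * ζ / (ζ - z) ^ 2) (Metric.sphere 0 |1|) := by
    refine ContinuousOn.div (by fun_prop) (by fun_prop) fun ζ hζ => pow_ne_zero 2 ?_
    rw [sub_ne_zero]
    rintro rfl
    rw [mem_sphere_zero_iff_norm, abs_one] at hζ
    rw [mem_ball_zero_iff] at hz
    linarith
  have h0 := herglotzDeriv_const c hz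
  rw [herglotzDeriv] at h0 ⊢
  simp only [smul_sub]
  have h1 : CircleIntegrable (fun ζ => (2 * ζ / (ζ - z) ^ 2) • G ζ) 0 1 := hG.continuousOn_smul hk
  have h2 : CircleIntegrable (fun ζ => (2 * ζ / (ζ - z) ^ 2) • c) 0 1 :=
    (circleIntegrable_const c 0 1).continuousOn_smul hk
  rw [Real.circleAverage_fun_sub h1 h2, h0, sub_zero]

lemma norm_herglotzDeriv_kernel_le {y θ s : ℝ} (h0 : 0 < y) (h1 : y ≤ 1) (h : |s - θ| ≤ Real.pi) :
    ‖2 * circleMap 0 1 s / (circleMap 0 1 s - polarPoint y θ) ^ 2‖ ≤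
      2 * (1 + Real.pi ^ 2) * (y ^ 2 + (s - θ) ^ 2)⁻¹ := by
  have hl := sq_add_sq_le_norm_sub_polarPoint h0 h1 h
  rw [norm_div, norm_mul, Complex.norm_two, norm_circleMap_zero, abs_one, norm_pow, mul_one]
  calc _ ≤ 2 / ((y ^ 2 + (s - θ) ^ 2) / (1 + Real.pi ^ 2)) := by gcongr
    _ = _ := by rw [div_div_eq_mul_div, div_eq_mul_inv]

/-- The gradient of the Poisson integral at `(1 - y) e^{iθ}` is controlled by the differences of
`g` at `θ`, because the kernel `2ζ / (ζ - z)²` annihilates constants. -/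
lemma ofReal_gradSq_polarPoint_le {g : ℝ → ℂ} (hg : Continuous g)
    (hper : Function.Periodic g (2 * Real.pi)) {y : ℝ} (h0 : 0 < y) (h1 : y ≤ 1) (θ : ℝ) :
    ENNReal.ofReal (gradSq (poissonAverage (boundaryFun g)) (polarPoint y θ)) ≤
      2 * (ENNReal.ofReal (2 * (1 + Real.pi ^ 2)) * ∫⁻ t in Ioo 0 Real.pi,
        twoSidedDiff g θ t * ENNReal.ofReal (y ^ 2 + t ^ 2)⁻¹) ^ 2 := by
  have hG := circleIntegrable_boundaryFun hg hper
  have hz := polarPoint_mem_ball h0 h1 θ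
  have hA : 0 ≤ 2 * (1 + Real.pi ^ 2) := by positivity
  have hk := fun s (hs : |s - θ| ≤ Real.pi) => norm_herglotzDeriv_kernel_le h0 h1 hs
  rw [gradSq_poissonAverage hG hz, ENNReal.ofReal_add (by positivity) (by positivity),
    ENNReal.ofReal_pow (norm_nonneg _), ENNReal.ofReal_pow (norm_nonneg _), ofReal_norm,
    ofReal_norm, two_mul (_ ^ 2), herglotzDeriv_sub_const hG (g θ) hz,
    herglotzDeriv_sub_const (circleIntegrable_conj hG) (starRingEnd ℂ (g θ)) hz]
  gcongr
  · exact enorm_circleAverage_le hg hper hA (fun s => by rw [boundaryFun_circleMap hper]) hk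
  · refine enorm_circleAverage_le hg hper hA (fun s => ?_) hk
    rw [boundaryFun_circleMap hper, ← map_sub, ← ofReal_norm, RCLike.norm_conj, ofReal_norm]

lemma enorm_poissonAverage_sub_boundary_le {g : ℝ → ℂ} (hg : Continuous g)
    (hper : Function.Periodic g (2 * Real.pi)) {y : ℝ} (h0 : 0 < y) (h1 : y ≤ 1) (θ : ℝ) :
    ‖poissonAverage (boundaryFun g) (polarPoint y θ) - g θ‖ₑ ≤
      ENNReal.ofReal (2 * y * (1 + Real.pi ^ 2)) * ∫⁻ t in Ioo 0 Real.pi,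
        twoSidedDiff g θ t * ENNReal.ofReal (y ^ 2 + t ^ 2)⁻¹ := by
  have hG := circleIntegrable_boundaryFun hg hper
  have hz := polarPoint_mem_ball h0 h1 θ
  have hKc : ContinuousOn (fun ζ => (poissonKernel 0 (polarPoint y θ) ζ : ℂ))
      (Metric.sphere 0 |1|) := by
    rw [poissonKernel_eq_re_herglotzRieszKernel]
    exact Complex.continuous_ofReal.comp_continuousOn
      (Complex.continuous_re.comp_continuousOn (continuousOn_herglotzRieszKernel_sphere hz))
  have heq : poissonAverage (boundaryFun g) (polarPoint y θ) - g θ =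
      Real.circleAverage (fun ζ => (poissonKernel 0 (polarPoint y θ) ζ : ℂ) •
        (boundaryFun g ζ - g θ)) 0 1 := by
    have h1 : CircleIntegrable (fun ζ => (poissonKernel 0 (polarPoint y θ) ζ : ℂ) •
        boundaryFun g ζ) 0 1 := hG.continuousOn_smul hKc
    have h2 : CircleIntegrable (fun ζ => (poissonKernel 0 (polarPoint y θ) ζ : ℂ) • g θ) 0 1 :=
      (circleIntegrable_const (g θ) 0 1).continuousOn_smul hKc
    have h3 := poissonAverage_const (g θ) hz
    simp only [smul_sub]
    rw [Real.circleAverage_fun_sub h1 h2]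
    simp only [poissonAverage, Complex.coe_smul] at h3 ⊢
    rw [h3]
  rw [heq]
  refine enorm_circleAverage_le hg hper (by positivity)
    (fun s => by rw [boundaryFun_circleMap hper]) fun s hs => ?_
  have hl := sq_add_sq_le_norm_sub_polarPoint h0 h1 hs
  rw [Complex.norm_real, poissonKernel_def]
  simp only [sub_zero]
  rw [norm_circleMap_zero, abs_one, norm_polarPoint h1, Real.norm_of_nonneg (by
    apply div_nonneg _ (by positivity)
    nlinarith)]
  calc _ ≤ (2 * y) / ((y ^ 2 + (s - θ) ^ 2) / (1 + Real.pi ^ 2)) := by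
        gcongr
        nlinarith
    _ = _ := by rw [div_div_eq_mul_div, div_eq_mul_inv]

lemma PeriodicHolder.twoSidedDiff_le {α M : ℝ} {g : ℝ → ℂ} (hg : PeriodicHolder α M g) (θ : ℝ)
    {t : ℝ} (ht : 0 < t) : twoSidedDiff g θ t ≤ ENNReal.ofReal (2 * M * t ^ α) := by
  have hM := hg.nonneg
  rw [show 2 * M * t ^ α = M * t ^ α + M * t ^ α by ring,
    ENNReal.ofReal_add (by positivity) (by positivity), twoSidedDiff]
  refine add_le_add ?_ ?_ <;> rw [← ofReal_norm] <;> apply ENNReal.ofReal_le_ofReal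
  · simpa [abs_of_pos ht] using hg.norm_sub_le (θ + t) θ
  · simpa [abs_of_pos ht] using hg.norm_sub_le (θ - t) θ

/-- The Poisson integral of a Hölder function has radial limits. -/
lemma PeriodicHolder.tendsto_poissonAverage {α M : ℝ} {g : ℝ → ℂ} (hg : PeriodicHolder α M g)
    (hα0 : 0 < α) (hα1 : α < 1) (θ : ℝ) :
    Tendsto (fun y => poissonAverage (boundaryFun g) (polarPoint y θ)) (𝓝[>] 0) (𝓝 (g θ)) := by
  have hπ := Real.pi_pos
  have hM := hg.nonneg
  set B : ℝ := 2 * (1 + Real.pi ^ 2) * (2 * M) * (Real.pi ^ (α / 2) / (α / 2)) with hB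
  have hbound : ∀ y ∈ Ioc (0 : ℝ) 1,
      ‖poissonAverage (boundaryFun g) (polarPoint y θ) - g θ‖ ≤ B * y ^ (α / 2) := by
    rintro y ⟨h0, h1⟩
    rw [← ENNReal.ofReal_le_ofReal_iff (by positivity), ofReal_norm]
    refine (enorm_poissonAverage_sub_boundary_le (hg.continuous hα0) hg.periodic h0 h1 θ).trans ?_
    calc _ ≤ ENNReal.ofReal (2 * y * (1 + Real.pi ^ 2)) * ∫⁻ t in Ioo 0 Real.pi,
          ENNReal.ofReal (2 * M * y ^ (α / 2 - 1)) * ENNReal.ofReal (t ^ (α / 2 - 1)) := by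
          refine mul_le_mul_right ?_ _
          refine setLIntegral_mono' measurableSet_Ioo fun t ht => ?_
          have ht0 := ht.1
          refine (mul_le_mul_left (hg.twoSidedDiff_le θ ht0) _).trans ?_
          rw [← ENNReal.ofReal_mul (by positivity), ← ENNReal.ofReal_mul (by positivity)]
          apply ENNReal.ofReal_le_ofReal
          -- `y² + t²` is at least `max(y, t)²`, hence at least `y^{1-α/2} t^{1+α/2}`
          have hgm : y ^ (1 - α / 2) * t ^ (1 + α / 2) ≤ y ^ 2 + t ^ 2 := by
            set m := max y t with hm
            have hm0 : 0 < m := lt_max_of_lt_left h0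
            calc _ ≤ m ^ (1 - α / 2) * m ^ (1 + α / 2) := by
                  gcongr
                  · linarith
                  · exact le_max_left _ _
                  · exact le_max_right _ _
              _ = m ^ 2 := by
                  rw [← Real.rpow_add hm0,
                    show 1 - α / 2 + (1 + α / 2) = (2 : ℕ) by push_cast; ring,
                    Real.rpow_natCast]
              _ ≤ _ := by
                  rcases max_choice y t with h | h <;> rw [hm, h] <;> nlinarith
          calc 2 * M * t ^ α * (y ^ 2 + t ^ 2)⁻¹
              ≤ 2 * M * t ^ α * (y ^ (1 - α / 2) * t ^ (1 + α / 2))⁻¹ := by gcongr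
            _ = _ := by
                rw [mul_inv, ← Real.rpow_neg h0.le, ← Real.rpow_neg ht0.le, mul_left_comm,
                  show α / 2 - 1 = α + -(1 + α / 2) by ring, Real.rpow_add ht0,
                  show α + -(1 + α / 2) = -(1 - α / 2) by ring]
                ring
      _ = _ := by
          rw [lintegral_const_mul' _ _ ENNReal.ofReal_ne_top,
            setLIntegral_Ioo_rpow (by linarith) hπ.le, ← ENNReal.ofReal_mul (by positivity),
            ← ENNReal.ofReal_mul (by positivity)]
          congr 1
          rw [hB, sub_add_cancel, Real.rpow_sub_one h0.ne']
          field_simp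
  rw [tendsto_iff_norm_sub_tendsto_zero]
  refine squeeze_zero' (Eventually.of_forall fun _ => norm_nonneg _)
    (g := fun y => B * y ^ (α / 2)) ?_ ?_
  · filter_upwards [Ioo_mem_nhdsGT (show (0 : ℝ) < 1 by norm_num)] with y hy using
      hbound y (Ioo_subset_Ioc_self hy)
  · have : ContinuousAt (fun y : ℝ => B * y ^ (α / 2)) 0 :=
      continuousAt_const.mul (ContinuousAt.rpow_const (by fun_prop) (Or.inr (by positivity)))
    have h := this.tendsto
    simp only [Real.zero_rpow (by positivity : α / 2 ≠ 0), mul_zero] at h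
    exact h.mono_left nhdsWithin_le_nhds

/-! ### From differences to the gradient -/

/-- `|∇ĝ|²` at the point `(1 - y) e^{iθ}`, for the Poisson integral `ĝ` of `g`. -/
noncomputable def gradDensity (g : ℝ → ℂ) (y θ : ℝ) : ENNReal :=
  ENNReal.ofReal (gradSq (poissonAverage (boundaryFun g)) (polarPoint y θ))

/-- The integral of `|∇ĝ|² y^σ` over the angles of `I` and the distances `y < κ |I|` to the
circle. -/
noncomputable def gradEnergy (σ κ : ℝ) (g : ℝ → ℂ) (I : Arc) : ENNReal :=
  ∫⁻ θ in I.angles, ∫⁻ y in Ioo 0 (κ * I.len), gradDensity g y θ * ENNReal.ofReal (y ^ σ)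

lemma measurable_gradSq (F : ℂ → ℂ) : Measurable (gradSq F) := by
  unfold gradSq dz dzbar
  fun_prop

lemma continuous_polarPoint : Continuous fun p : ℝ × ℝ => polarPoint p.1 p.2 := by
  unfold polarPoint; fun_prop

lemma measurable_gradDensity (g : ℝ → ℂ) :
    Measurable fun p : ℝ × ℝ => gradDensity g p.1 p.2 :=
  ((measurable_gradSq _).comp continuous_polarPoint.measurable).ennreal_ofReal

attribute [irreducible] gradDensity

lemma measurable_gradDensity_comp {X : Type*} [MeasurableSpace X] {g : ℝ → ℂ} {a b : X → ℝ}
    (ha : Measurable a) (hb : Measurable b) : Measurable fun x => gradDensity g (a x) (b x) :=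
  (measurable_gradDensity g).comp (ha.prodMk hb)

lemma measurable_twoSidedDiff {g : ℝ → ℂ} (hg : Continuous g) (θ : ℝ) :
    Measurable (twoSidedDiff g θ) := by
  have := hg.measurable
  change Measurable fun t => ‖g (θ + t) - g θ‖ₑ + ‖g (θ - t) - g θ‖ₑ
  fun_prop

lemma add_sq_le_two_mul_add_sq (a b : ENNReal) : (a + b) ^ 2 ≤ 2 * (a ^ 2 + b ^ 2) := by
  rcases eq_or_ne a ⊤ with rfl | ha
  · simp
  rcases eq_or_ne b ⊤ with rfl | hb
  · simp
  lift a to NNReal using ha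
  lift b to NNReal using hb
  exact_mod_cast (by simpa using add_pow_le (zero_le (a := a)) (zero_le (a := b)) 2)

lemma twoSidedDiff_sq_mul_le {σ : ℝ} (g : ℝ → ℂ) (θ : ℝ) {t : ℝ} (ht : 0 < t) :
    twoSidedDiff g θ t ^ 2 * ENNReal.ofReal (t ^ (σ - 2)) ≤
      2 * (diffKernel σ g θ (θ + t) + diffKernel σ g θ (θ - t)) := by
  have e : ∀ u, |θ - u| = t →
      diffKernel σ g θ u = ‖g u - g θ‖ₑ ^ 2 * ENNReal.ofReal (t ^ (σ - 2)) := by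
    intro u hu
    rw [diffKernel, hu, norm_sub_rev, ENNReal.ofReal_mul (by positivity),
      ENNReal.ofReal_pow (norm_nonneg _), ofReal_norm]
  rw [e (θ + t) (by rw [show θ - (θ + t) = -t by ring, abs_neg, abs_of_pos ht]),
    e (θ - t) (by rw [show θ - (θ - t) = t by ring, abs_of_pos ht]), ← add_mul, ← mul_assoc]
  exact mul_le_mul_left (add_sq_le_two_mul_add_sq _ _) _

lemma PeriodicHolder.setLIntegral_twoSidedDiff_mul_kernel_le {α M : ℝ} {g : ℝ → ℂ}
    (hg : PeriodicHolder α M g) (hα1 : α < 1) {δ : ℝ} (hδ : 0 < δ) (b θ y : ℝ) :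
    ∫⁻ t in Ioo δ b, twoSidedDiff g θ t * ENNReal.ofReal (y ^ 2 + t ^ 2)⁻¹ ≤
      ENNReal.ofReal (2 * M / (1 - α) * δ ^ (α - 1)) := by
  have hM := hg.nonneg
  calc _ ≤ ∫⁻ t in Ioi δ, ENNReal.ofReal (2 * M) * ENNReal.ofReal (t ^ (α - 2)) := by
        refine (setLIntegral_mono' measurableSet_Ioo fun t ht => ?_).trans
          (lintegral_mono_set Ioo_subset_Ioi_self)
        have ht0 : 0 < t := hδ.trans ht.1
        refine (mul_le_mul_left (hg.twoSidedDiff_le θ ht0) _).trans ?_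
        rw [← ENNReal.ofReal_mul (by positivity), ← ENNReal.ofReal_mul (by positivity)]
        apply ENNReal.ofReal_le_ofReal
        rw [show α - 2 = α + -((2 : ℕ) : ℝ) by push_cast; ring, Real.rpow_add ht0,
          Real.rpow_neg ht0.le, Real.rpow_natCast, ← mul_assoc]
        gcongr
        nlinarith [sq_nonneg y]
    _ = _ := by
        rw [lintegral_const_mul' _ _ ENNReal.ofReal_ne_top,
          setLIntegral_Ioi_rpow (by linarith) hδ, ← ENNReal.ofReal_mul (by positivity),
          show α - 2 + 1 = α - 1 by ring, neg_sub]
        congr 1; ring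

/-- The weighted integral of the gradient along a radius. The differences of `g` at distance less
than `δ` enter through `exists_lintegral_sq_kernel_le`; the remaining ones are controlled by the
Hölder condition. -/
lemma PeriodicHolder.exists_setLIntegral_gradDensity_le {α M σ : ℝ} {g : ℝ → ℂ}
    (hg : PeriodicHolder α M g) (hα0 : 0 < α) (hα1 : α < 1) (hσ0 : 0 < σ) (hσ1 : σ < 1) :
    ∃ C : ENNReal, C ≠ ⊤ ∧ ∀ θ δ l : ℝ, 0 < δ → 0 < l → l ≤ 1 →
      ∫⁻ y in Ioo 0 l, gradDensity g y θ * ENNReal.ofReal (y ^ σ) ≤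
        C * ((∫⁻ t in Ioo 0 δ, diffKernel σ g θ (θ + t)) +
          (∫⁻ t in Ioo 0 δ, diffKernel σ g θ (θ - t)) +
          ENNReal.ofReal ((δ ^ (α - 1)) ^ 2 * l ^ (σ + 1))) := by
  have hgc := hg.continuous hα0
  have hM := hg.nonneg
  obtain ⟨C, hC, hCK⟩ := exists_lintegral_sq_kernel_le hσ0 hσ1
  obtain ⟨A, hA⟩ : ∃ A, A = ENNReal.ofReal (2 * (1 + Real.pi ^ 2)) := ⟨_, rfl⟩
  obtain ⟨B, hB⟩ : ∃ B, B = ENNReal.ofReal ((2 * M / (1 - α)) ^ 2 / (σ + 1)) := ⟨_, rfl⟩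
  have hA2 : 2 * A ^ 2 * 2 ≠ ⊤ := by rw [hA]; finiteness
  have htop : 2 * A ^ 2 * 2 * (C * 2 + B) ≠ ⊤ := by rw [hA, hB]; finiteness
  refine ⟨_, htop, fun θ δ l hδ hl hl1 => ?_⟩
  obtain ⟨near, hnear⟩ : ∃ near : ℝ → ENNReal, near = fun y =>
    ∫⁻ t in Ioo 0 δ, twoSidedDiff g θ t * ENNReal.ofReal (y ^ 2 + t ^ 2)⁻¹ := ⟨_, rfl⟩
  obtain ⟨F, hF⟩ : ∃ F, F = ENNReal.ofReal (2 * M / (1 - α) * δ ^ (α - 1)) := ⟨_, rfl⟩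
  have hpt : ∀ y ∈ Ioo 0 l, gradDensity g y θ * ENNReal.ofReal (y ^ σ) ≤
      2 * A ^ 2 * 2 * (near y ^ 2 * ENNReal.ofReal (y ^ σ) + F ^ 2 * ENNReal.ofReal (y ^ σ)) := by
    intro y hy
    have hgrad := ofReal_gradSq_polarPoint_le hgc hg.periodic hy.1 (hy.2.le.trans hl1) θ
    rw [← hA] at hgrad
    rw [← add_mul, ← mul_assoc, gradDensity]
    refine mul_le_mul_left (hgrad.trans ?_) _
    rw [mul_pow, ← mul_assoc, mul_assoc _ 2]
    refine mul_le_mul_right (le_trans ?_ (add_sq_le_two_mul_add_sq _ _)) _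
    gcongr
    rw [hnear, hF]
    exact (setLIntegral_Ioo_le_add _ 0 δ Real.pi).trans
      (add_le_add_right (hg.setLIntegral_twoSidedDiff_mul_kernel_le hα1 hδ _ θ y) _)
  have hm := measurable_twoSidedDiff hgc θ
  have hmnear : Measurable near := by
    have : Measurable (Function.uncurry fun y t : ℝ =>
        twoSidedDiff g θ t * ENNReal.ofReal (y ^ 2 + t ^ 2)⁻¹) :=
      (hm.comp measurable_snd).mul (by fun_prop)
    rw [hnear]
    exact this.lintegral_prod_right'
  have hmnear2 : Measurable fun y => near y ^ 2 * ENNReal.ofReal (y ^ σ) :=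
    (hmnear.pow_const 2).mul (by fun_prop)
  have hmd : Measurable fun t => diffKernel σ g θ (θ + t) :=
    (measurable_diffKernel_add hgc σ).of_uncurry_left
  have h1 : ∫⁻ y in Ioo 0 l, near y ^ 2 * ENNReal.ofReal (y ^ σ) ≤
      C * (2 * ((∫⁻ t in Ioo 0 δ, diffKernel σ g θ (θ + t)) +
        ∫⁻ t in Ioo 0 δ, diffKernel σ g θ (θ - t))) := by
    rw [hnear]
    refine (lintegral_mono_set Ioo_subset_Ioi_self).trans ((hCK δ _ hm).trans ?_)
    refine mul_le_mul_right ?_ _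
    rw [← lintegral_add_left hmd, ← lintegral_const_mul' _ _ (by finiteness)]
    exact setLIntegral_mono' measurableSet_Ioo fun t ht => twoSidedDiff_sq_mul_le g θ ht.1
  have h2 : ∫⁻ y in Ioo 0 l, F ^ 2 * ENNReal.ofReal (y ^ σ) =
      B * ENNReal.ofReal ((δ ^ (α - 1)) ^ 2 * l ^ (σ + 1)) := by
    rw [hF, lintegral_const_mul' _ _ (ENNReal.pow_ne_top ENNReal.ofReal_ne_top),
      setLIntegral_Ioo_rpow (by linarith) hl.le,
      hB, ← ENNReal.ofReal_pow (by positivity), ← ENNReal.ofReal_mul (by positivity),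
      ← ENNReal.ofReal_mul (by positivity)]
    congr 1
    ring
  refine (setLIntegral_mono' measurableSet_Ioo hpt).trans ?_
  rw [lintegral_const_mul' _ _ hA2, lintegral_add_left hmnear2, h2, mul_assoc (2 * A ^ 2 * 2)]
  refine mul_le_mul_right ((add_le_add_left h1 _).trans ?_) _
  rw [add_mul, ← mul_assoc]
  exact add_le_add (mul_le_mul_right le_self_add _) (mul_le_mul_right le_add_self _)

/-- Integration of the radial estimate over the halves of an arc. -/
lemma ArcBound.gradEnergy_of_diffEnergy {α M σ : ℝ} {g : ℝ → ℂ} (hg : PeriodicHolder α M g)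
    (hα0 : 0 < α) (hα1 : α < 1) (hσ0 : 0 < σ) (hσ1 : σ < 1)
    (h : ArcBound (σ + 2 * α) (diffEnergy σ g)) :
    ArcBound (σ + 2 * α) (gradEnergy σ 1 g) := by
  have hgc := hg.continuous hα0
  obtain ⟨C, hC, hCθ⟩ := hg.exists_setLIntegral_gradDensity_le hα0 hα1 hσ0 hσ1
  set D : ℝ := ((Real.pi / 2) ^ (α - 1)) ^ 2 * Real.pi with hD
  have hD0 : 0 ≤ D := by positivity
  -- the bound for one half of an arc
  set X : Arc → ENNReal := fun J => C * (diffEnergy σ g J + diffEnergy σ g J +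
    ENNReal.ofReal D * ENNReal.ofReal (J.len ^ (σ + 2 * α)))
  have hXb : ArcBound (σ + 2 * α) X :=
    ((h.add h).add ⟨ENNReal.ofReal D, ENNReal.ofReal_ne_top, fun J => le_rfl⟩).mono hC
      fun J => le_rfl
  refine ((hXb.comp_rotate fun I => -((I.right - I.left) / 4)).add
    (hXb.comp_rotate fun I => (I.right - I.left) / 4)).mono ENNReal.one_ne_top fun I => ?_
  rw [one_mul]
  refine setLIntegral_angles_le_of_halves I (X := X) fun J c d hJ hc hd hcd hcd' => ?_
  have hlen := I.len_pos
  have hIL := I.right_sub_left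
  set δ := (I.right - I.left) / 4 with hδ
  have hδ' : δ = Real.pi / 2 * I.len := by rw [hδ, hIL]; ring
  have hδ0 : 0 < δ := by rw [hδ']; positivity
  rw [one_mul]
  refine (lintegral_mono fun θ => hCθ θ δ I.len hδ0 hlen I.len_le_one).trans ?_
  have hm3 : Measurable fun θ => ∫⁻ t in Ioo 0 δ, diffKernel σ g θ (θ + t) :=
    (measurable_diffKernel_add hgc σ).lintegral_prod_right'
  rw [lintegral_const_mul' _ _ hC, lintegral_add_right _ measurable_const,
    lintegral_add_left hm3]
  refine mul_le_mul_right (add_le_add (add_le_add ?_ ?_) ?_) _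
  · exact setLIntegral_comp_add_le_diffEnergy g J (by linarith) hd hδ0.le
  · exact setLIntegral_comp_sub_le_diffEnergy g J hc (by linarith) hδ0.le
  · rw [lintegral_const, Measure.restrict_apply MeasurableSet.univ, univ_inter, Real.volume_Ioo,
      hcd', hIL, hJ, ← ENNReal.ofReal_mul (by positivity), ← ENNReal.ofReal_mul hD0]
    apply le_of_eq
    congr 1
    rw [hδ', Real.mul_rpow (by positivity) hlen.le, hD,
      show σ + 2 * α = (α - 1) + (α - 1) + (σ + 1) + 1 by ring, Real.rpow_add_one hlen.ne' (_ + _),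
      Real.rpow_add hlen (α - 1 + (α - 1)) (σ + 1), Real.rpow_add hlen (α - 1) (α - 1)]
    ring

/-! ### From the gradient to differences -/

lemma hasDerivAt_polarPoint_left (y θ : ℝ) :
    HasDerivAt (fun y => polarPoint y θ) (-Complex.exp (θ * Complex.I)) y := by
  have h : HasDerivAt (fun y : ℝ => ((1 - y : ℝ) : ℂ)) ((-1 : ℝ) : ℂ) y :=
    ((hasDerivAt_id y).const_sub 1).ofReal_comp
  simpa [polarPoint] using h.mul_const (Complex.exp (θ * Complex.I))

lemma hasDerivAt_polarPoint_right (y θ : ℝ) :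
    HasDerivAt (fun θ => polarPoint y θ)
      ((1 - y : ℝ) * (Complex.exp (θ * Complex.I) * Complex.I)) θ := by
  have h : HasDerivAt (fun θ : ℝ => (θ : ℂ) * Complex.I) Complex.I θ := by
    simpa using (hasDerivAt_id θ).ofReal_comp.mul_const Complex.I
  exact h.cexp.const_mul _

/-- The square root of `gradDensity`. -/
noncomputable def gradNorm (g : ℝ → ℂ) (y θ : ℝ) : ENNReal :=
  ENNReal.ofReal (Real.sqrt (gradSq (poissonAverage (boundaryFun g)) (polarPoint y θ)))

lemma gradNorm_sq (g : ℝ → ℂ) (y θ : ℝ) : gradNorm g y θ ^ 2 = gradDensity g y θ := by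
  rw [gradNorm, gradDensity, ← ENNReal.ofReal_pow (Real.sqrt_nonneg _), Real.sq_sqrt]
  unfold gradSq; positivity

lemma measurable_gradNorm (g : ℝ → ℂ) : Measurable fun p : ℝ × ℝ => gradNorm g p.1 p.2 := by
  have := ((measurable_gradSq (poissonAverage (boundaryFun g))).comp
    continuous_polarPoint.measurable)
  exact (Real.continuous_sqrt.measurable.comp this).ennreal_ofReal

/-- The distance between the boundary value and the value at depth `t` is controlled by the
gradient along the radius. -/
lemma PeriodicHolder.enorm_radial_le {α M : ℝ} {g : ℝ → ℂ} (hg : PeriodicHolder α M g)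
    (hα0 : 0 < α) (hα1 : α < 1) (θ : ℝ) {t : ℝ} (ht0 : 0 < t) (ht1 : t ≤ 1) :
    ‖poissonAverage (boundaryFun g) (polarPoint t θ) - g θ‖ₑ ≤ ∫⁻ y in Ioo 0 t, gradNorm g y θ := by
  have hG := circleIntegrable_boundaryFun (hg.continuous hα0) hg.periodic
  have hlim : Tendsto (fun ε => ‖poissonAverage (boundaryFun g) (polarPoint t θ) -
      poissonAverage (boundaryFun g) (polarPoint ε θ)‖ₑ) (𝓝[>] 0)
      (𝓝 ‖poissonAverage (boundaryFun g) (polarPoint t θ) - g θ‖ₑ) :=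
    (tendsto_const_nhds.sub (hg.tendsto_poissonAverage hα0 hα1 θ)).enorm
  refine le_of_tendsto hlim ?_
  filter_upwards [Ioo_mem_nhdsGT ht0] with ε hε
  refine (enorm_poissonAverage_sub_le hG (fun y => hasDerivAt_polarPoint_left y θ)
    continuous_const hε.2.le (fun y hy => polarPoint_mem_ball (hε.1.trans_le hy.1)
      (hy.2.trans ht1) θ) fun y => ?_).trans (lintegral_mono_set (Ioo_subset_Ioo hε.1.le le_rfl))
  rw [norm_neg, Complex.norm_exp_ofReal_mul_I]

lemma PeriodicHolder.enorm_angular_le {α M : ℝ} {g : ℝ → ℂ} (hg : PeriodicHolder α M g)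
    (hα0 : 0 < α) {t : ℝ} (ht0 : 0 < t) (ht1 : t ≤ 1) (s : ℝ) {v : ℝ} (hv : 0 ≤ v) :
    ‖poissonAverage (boundaryFun g) (polarPoint t (s + v)) -
      poissonAverage (boundaryFun g) (polarPoint t s)‖ₑ ≤
      ∫⁻ φ in Ioo 0 v, gradNorm g t (s + φ) := by
  have hG := circleIntegrable_boundaryFun (hg.continuous hα0) hg.periodic
  rw [setLIntegral_Ioo_comp_add (fun φ => gradNorm g t φ), add_zero]
  refine enorm_poissonAverage_sub_le hG (fun θ => hasDerivAt_polarPoint_right t θ)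
    (by fun_prop) (by linarith) (fun y _ => polarPoint_mem_ball ht0 ht1 y) fun y => ?_
  rw [norm_mul, norm_mul, Complex.norm_exp_ofReal_mul_I, Complex.norm_I, Complex.norm_real,
    Real.norm_of_nonneg (by linarith)]
  linarith

attribute [irreducible] gradNorm

lemma measurable_gradNorm_comp {X : Type*} [MeasurableSpace X] {g : ℝ → ℂ} {a b : X → ℝ}
    (ha : Measurable a) (hb : Measurable b) : Measurable fun x => gradNorm g (a x) (b x) :=
  (measurable_gradNorm g).comp (ha.prodMk hb)

lemma measurable_setLIntegral_Ioo_zero {K : ℝ × ℝ → ℝ → ENNReal}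
    (hK : Measurable (Function.uncurry K)) :
    Measurable fun p : ℝ × ℝ => ∫⁻ v in Ioo 0 p.2, K p v := by
  have hi : Measurable fun q : (ℝ × ℝ) × ℝ => (Iio q.1.2).indicator (K q.1) q.2 := by
    have : (fun q : (ℝ × ℝ) × ℝ => (Iio q.1.2).indicator (K q.1) q.2) =
        {q : (ℝ × ℝ) × ℝ | q.2 < q.1.2}.indicator (Function.uncurry K) := by
      ext q; simp [indicator, Function.uncurry]
    rw [this]
    exact hK.indicator (measurableSet_lt measurable_snd (measurable_snd.comp measurable_fst))
  have e : (fun p : ℝ × ℝ => ∫⁻ v in Ioo 0 p.2, K p v) =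
      fun p => ∫⁻ v in Ioi 0, (Iio p.2).indicator (K p) v := by
    ext p
    rw [setLIntegral_indicator measurableSet_Iio, Iio_inter_Ioi]
  rw [e]
  exact hi.lintegral_prod_right'

lemma lintegral_linearCombination {X : Type*} [MeasurableSpace X] {μ : Measure X}
    {f₁ f₂ f₃ : X → ENNReal} (h₁ : Measurable f₁) (h₂ : Measurable f₂) {a b c : ENNReal}
    (ha : a ≠ ⊤) (hb : b ≠ ⊤) (hc : c ≠ ⊤) :
    ∫⁻ x, a * f₁ x + b * f₂ x + c * f₃ x ∂μ =
      a * ∫⁻ x, f₁ x ∂μ + b * ∫⁻ x, f₂ x ∂μ + c * ∫⁻ x, f₃ x ∂μ := by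
  have h : Measurable fun x => a * f₁ x + b * f₂ x := (h₁.const_mul a).add (h₂.const_mul b)
  rw [lintegral_add_left h, lintegral_add_left (h₁.const_mul a), lintegral_const_mul' _ _ ha,
    lintegral_const_mul' _ _ hb, lintegral_const_mul' _ _ hc]

lemma lintegral_comp_add_le {K : ℝ → ℝ → ENNReal} (hK : Measurable (Function.uncurry K))
    {c d T : ℝ} :
    ∫⁻ s in Ioo c d, ∫⁻ t in Ioo 0 T, K (s + t) t ≤
      ∫⁻ s in Ioo c (d + T), ∫⁻ t in Ioo 0 T, K s t := by
  have h1 : Measurable (Function.uncurry fun s t : ℝ => K (s + t) t) :=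
    hK.comp ((measurable_fst.add measurable_snd).prodMk measurable_snd)
  rw [lintegral_lintegral_swap h1.aemeasurable, lintegral_lintegral_swap hK.aemeasurable]
  refine setLIntegral_mono' measurableSet_Ioo fun t ht => ?_
  have := setLIntegral_Ioo_comp_add (fun s => K s t) c d t
  simp only [add_comm t] at this
  rw [this]
  exact lintegral_mono_set (Ioo_subset_Ioo (by linarith [ht.1]) (by linarith [ht.2]))

lemma lintegral_lintegral_comp_add_le {K : ℝ → ℝ → ENNReal}
    (hK : Measurable (Function.uncurry K)) {c d T : ℝ} :
    ∫⁻ s in Ioo c d, ∫⁻ t in Ioo 0 T, ∫⁻ v in Ioo 0 t, K (s + v) t ≤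
      ∫⁻ s in Ioo c (d + T), ∫⁻ t in Ioo 0 T, ENNReal.ofReal t * K s t := by
  have h1 : Measurable (Function.uncurry fun s t : ℝ => ∫⁻ v in Ioo 0 t, K (s + v) t) :=
    measurable_setLIntegral_Ioo_zero (K := fun p v => K (p.1 + v) p.2)
      (hK.comp ((measurable_fst.fst.add measurable_snd).prodMk measurable_fst.snd))
  have h2 : Measurable (Function.uncurry fun s t : ℝ => ENNReal.ofReal t * K s t) :=
    (measurable_snd.ennreal_ofReal).mul hK
  rw [lintegral_lintegral_swap h1.aemeasurable, lintegral_lintegral_swap h2.aemeasurable]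
  refine setLIntegral_mono' measurableSet_Ioo fun t ht => ?_
  have h3 : Measurable (Function.uncurry fun s v : ℝ => K (s + v) t) :=
    hK.comp ((measurable_fst.add measurable_snd).prodMk measurable_const)
  rw [lintegral_lintegral_swap h3.aemeasurable, lintegral_const_mul' _ _ ENNReal.ofReal_ne_top]
  calc _ ≤ ∫⁻ _ in Ioo 0 t, ∫⁻ s in Ioo c (d + T), K s t := by
        refine setLIntegral_mono' measurableSet_Ioo fun v hv => ?_
        have := setLIntegral_Ioo_comp_add (fun s => K s t) c d v
        simp only [add_comm v] at this
        rw [this]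
        exact lintegral_mono_set (Ioo_subset_Ioo (by linarith [hv.1]) (by linarith [hv.2, ht.2]))
    _ = _ := by
        rw [lintegral_const, Measure.restrict_apply MeasurableSet.univ, univ_inter,
          Real.volume_Ioo, sub_zero, mul_comm]

/-- The translations by `t ≥ |I| / 2` are harmless for a Hölder function. -/
lemma PeriodicHolder.arcBound_diffKernel_of_len_le {α M σ : ℝ} {g : ℝ → ℂ}
    (hg : PeriodicHolder α M g) (hα0 : 0 < α) (hσ1 : σ < 1) :
    ArcBound (σ + 2 * α) fun I => ∫⁻ s in I.angles, ∫⁻ t in Ioo (I.len / 2) I.len,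
      diffKernel σ g s (s + t) := by
  set E : ℝ := M ^ 2 * (1 ^ α) ^ 2 * (1 / 2) ^ (σ - 2)
  refine ⟨ENNReal.ofReal (E * (2 * Real.pi)), by finiteness, fun I => ?_⟩
  have hlen := I.len_pos
  calc _ ≤ ∫⁻ s in I.angles, ∫⁻ t in Ioo (I.len / 2) I.len,
        ENNReal.ofReal (E * I.len ^ (σ + 2 * α - 2)) := by
        refine lintegral_mono fun s => setLIntegral_mono' measurableSet_Ioo fun t ht => ?_
        have : |s - (s + t)| = t := by
          rw [show s - (s + t) = -t by ring, abs_neg, abs_of_pos (by linarith [ht.1])]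
        exact hg.diffKernel_le_of_le hα0 hσ1 (by norm_num) zero_le_one hlen
          (by rw [this]; linarith [ht.1]) (by rw [this]; linarith [ht.2])
    _ ≤ _ := by
        simp only [lintegral_const, Measure.restrict_apply MeasurableSet.univ, univ_inter,
          Arc.angles, Real.volume_Ioo, I.right_sub_left, sub_half]
        rw [← ENNReal.ofReal_mul (by positivity), ← ENNReal.ofReal_mul (by positivity),
          ← ENNReal.ofReal_mul (by positivity)]
        apply ENNReal.ofReal_le_ofReal
        rw [show σ + 2 * α = (σ + 2 * α - 2) + (2 : ℕ) by push_cast; ring,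
          Real.rpow_add_natCast hlen.ne', show σ + 2 * α - 2 + ((2 : ℕ) : ℝ) - 2 =
          σ + 2 * α - 2 by push_cast; ring]
        have : 0 ≤ E * I.len ^ (σ + 2 * α - 2) * (2 * Real.pi) * I.len ^ 2 := by positivity
        nlinarith

/-- The integral of the gradient along the radius over `e^{is}` from the circle to depth `t`. -/
noncomputable def radialIntegral (g : ℝ → ℂ) (s t : ℝ) : ENNReal :=
  ∫⁻ y in Ioo 0 t, gradNorm g y s

lemma measurable_radialIntegral (g : ℝ → ℂ) :
    Measurable (Function.uncurry (radialIntegral g)) :=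
  measurable_setLIntegral_Ioo_zero (K := fun p y => gradNorm g y p.1)
    (measurable_gradNorm_comp (by fun_prop) (by fun_prop))

/-- The way from `e^{is}` to `e^{i(s+t)}` inside the disc: along the radius down to depth `t`,
along the circle at depth `t`, and back along a radius. -/
lemma PeriodicHolder.diffKernel_add_le {α M σ : ℝ} {g : ℝ → ℂ} (hg : PeriodicHolder α M g)
    (hα0 : 0 < α) (hα1 : α < 1) (s : ℝ) {t : ℝ} (ht0 : 0 < t) (ht1 : t ≤ 1) :
    diffKernel σ g s (s + t) ≤
      (4 * (radialIntegral g s t ^ 2 * ENNReal.ofReal (t ^ (σ - 2))) +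
        4 * (radialIntegral g (s + t) t ^ 2 * ENNReal.ofReal (t ^ (σ - 2)))) +
        2 * ((∫⁻ v in Ioo 0 t, gradDensity g t (s + v)) * ENNReal.ofReal (t ^ (σ - 1))) := by
  have e : diffKernel σ g s (s + t) = ‖g (s + t) - g s‖ₑ ^ 2 * ENNReal.ofReal (t ^ (σ - 2)) := by
    rw [diffKernel, norm_sub_rev, ENNReal.ofReal_mul (by positivity),
      ENNReal.ofReal_pow (norm_nonneg _), ofReal_norm, show s - (s + t) = -t by ring, abs_neg,
      abs_of_pos ht0]
  have hr1 := hg.enorm_radial_le hα0 hα1 s ht0 ht1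
  have hr2 := hg.enorm_radial_le hα0 hα1 (s + t) ht0 ht1
  have ha := hg.enorm_angular_le hα0 ht0 ht1 s ht0.le
  have hcs : (∫⁻ v in Ioo 0 t, gradNorm g t (s + v)) ^ 2 ≤
      (∫⁻ v in Ioo 0 t, gradDensity g t (s + v)) * ENNReal.ofReal t := by
    have := sq_lintegral_mul_le (μ := volume.restrict (Ioo 0 t))
      (φ := fun v => gradNorm g t (s + v)) (w := fun _ => 1) (u := fun _ => 1) (v := fun _ => 1)
      (measurable_gradNorm_comp measurable_const (by fun_prop)).aemeasurable
      measurable_const measurable_const (by simp)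
    simpa [gradNorm_sq] using this
  set u := poissonAverage (boundaryFun g)
  have htri : ‖g (s + t) - g s‖ₑ ≤ (radialIntegral g s t + radialIntegral g (s + t) t) +
      ∫⁻ v in Ioo 0 t, gradNorm g t (s + v) := by
    calc ‖g (s + t) - g s‖ₑ = ‖(u (polarPoint t s) - g s) - (u (polarPoint t (s + t)) - g (s + t))
          + (u (polarPoint t (s + t)) - u (polarPoint t s))‖ₑ := by congr 1; ring
      _ ≤ _ := (enorm_add_le _ _).trans
          (add_le_add (enorm_sub_le.trans (add_le_add hr1 hr2)) ha)
  have hw : ENNReal.ofReal (t ^ (σ - 1)) = ENNReal.ofReal t * ENNReal.ofReal (t ^ (σ - 2)) := by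
    rw [← ENNReal.ofReal_mul ht0.le, show σ - 1 = (σ - 2) + 1 by ring, Real.rpow_add_one ht0.ne',
      mul_comm]
  rw [e, hw]
  calc _ ≤ (2 * (2 * (radialIntegral g s t ^ 2 + radialIntegral g (s + t) t ^ 2) +
        (∫⁻ v in Ioo 0 t, gradDensity g t (s + v)) * ENNReal.ofReal t)) *
        ENNReal.ofReal (t ^ (σ - 2)) := by
        refine mul_le_mul_left ((pow_le_pow_left' htri 2).trans
          ((add_sq_le_two_mul_add_sq _ _).trans ?_)) _
        exact mul_le_mul_right (add_le_add (add_sq_le_two_mul_add_sq _ _) hcs) _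
    _ = _ := by ring

/-- The two radial parts of the path in `diffKernel_add_le` are estimated by Hardy's inequality,
the circular part by moving the integrals over the angles. -/
lemma PeriodicHolder.exists_setLIntegral_diffKernel_le {α M σ : ℝ} {g : ℝ → ℂ}
    (hg : PeriodicHolder α M g) (hα0 : 0 < α) (hα1 : α < 1) (hσ1 : σ < 1) :
    ∃ C : ENNReal, C ≠ ⊤ ∧ ∀ c d T : ℝ, 0 < T → T ≤ 1 →
      ∫⁻ s in Ioo c d, ∫⁻ t in Ioo 0 T, diffKernel σ g s (s + t) ≤
        C * ∫⁻ θ in Ioo c (d + T), ∫⁻ y in Ioo 0 T,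
          gradDensity g y θ * ENNReal.ofReal (y ^ σ) := by
  obtain ⟨C, hC, hCH⟩ := exists_hardy_le hσ1
  refine ⟨4 * C + 4 * C + 2, by finiteness, fun c d T hT0 hT1 => ?_⟩
  set E := ∫⁻ θ in Ioo c (d + T), ∫⁻ y in Ioo 0 T,
    gradDensity g y θ * ENNReal.ofReal (y ^ σ) with hE
  have hmA : Measurable (Function.uncurry fun s t : ℝ =>
      radialIntegral g s t ^ 2 * ENNReal.ofReal (t ^ (σ - 2))) :=
    ((measurable_radialIntegral g).pow_const 2).mul (by fun_prop)
  have hmB : Measurable (Function.uncurry fun s t : ℝ =>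
      radialIntegral g (s + t) t ^ 2 * ENNReal.ofReal (t ^ (σ - 2))) :=
    hmA.comp ((measurable_fst.add measurable_snd).prodMk measurable_snd)
  have hA' : ∫⁻ s in Ioo c (d + T), ∫⁻ t in Ioo 0 T,
      radialIntegral g s t ^ 2 * ENNReal.ofReal (t ^ (σ - 2)) ≤ C * E := by
    rw [hE, ← lintegral_const_mul' _ _ hC]
    refine lintegral_mono fun s => ?_
    refine (hCH T (fun y => gradNorm g y s)
      (measurable_gradNorm_comp measurable_id measurable_const)).trans_eq ?_
    simp only [gradNorm_sq]
  have hA : ∫⁻ s in Ioo c d, ∫⁻ t in Ioo 0 T,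
      radialIntegral g s t ^ 2 * ENNReal.ofReal (t ^ (σ - 2)) ≤ C * E :=
    (lintegral_mono_set (Ioo_subset_Ioo le_rfl (by linarith))).trans hA'
  have hB : ∫⁻ s in Ioo c d, ∫⁻ t in Ioo 0 T,
      radialIntegral g (s + t) t ^ 2 * ENNReal.ofReal (t ^ (σ - 2)) ≤ C * E :=
    (lintegral_comp_add_le (K := fun s t => radialIntegral g s t ^ 2 *
      ENNReal.ofReal (t ^ (σ - 2))) hmA).trans hA'
  have hD : ∫⁻ s in Ioo c d, ∫⁻ t in Ioo 0 T,
      (∫⁻ v in Ioo 0 t, gradDensity g t (s + v)) * ENNReal.ofReal (t ^ (σ - 1)) ≤ E := by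
    have hK : Measurable (Function.uncurry fun s t : ℝ =>
        gradDensity g t s * ENNReal.ofReal (t ^ (σ - 1))) :=
      (measurable_gradDensity_comp measurable_snd measurable_fst).mul (by fun_prop)
    calc _ = ∫⁻ s in Ioo c d, ∫⁻ t in Ioo 0 T, ∫⁻ v in Ioo 0 t,
          gradDensity g t (s + v) * ENNReal.ofReal (t ^ (σ - 1)) := by
          refine lintegral_congr fun s => lintegral_congr fun t => ?_
          rw [lintegral_mul_const' _ _ ENNReal.ofReal_ne_top]
      _ ≤ _ := lintegral_lintegral_comp_add_le hK
      _ = _ := by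
          refine lintegral_congr fun s => setLIntegral_congr_fun measurableSet_Ioo fun t ht => ?_
          have ht0 := ht.1
          rw [mul_left_comm, ← ENNReal.ofReal_mul ht0.le]
          congr 2
          rw [Real.rpow_sub_one ht0.ne']
          field_simp
  calc _ ≤ ∫⁻ s in Ioo c d, ((4 * ∫⁻ t in Ioo 0 T,
          radialIntegral g s t ^ 2 * ENNReal.ofReal (t ^ (σ - 2))) +
        (4 * ∫⁻ t in Ioo 0 T, radialIntegral g (s + t) t ^ 2 * ENNReal.ofReal (t ^ (σ - 2)))) +
        2 * ∫⁻ t in Ioo 0 T, (∫⁻ v in Ioo 0 t, gradDensity g t (s + v)) *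
          ENNReal.ofReal (t ^ (σ - 1)) := by
        refine lintegral_mono fun s => ?_
        have hms1 : Measurable fun t => radialIntegral g s t ^ 2 * ENNReal.ofReal (t ^ (σ - 2)) :=
          hmA.of_uncurry_left
        have hms2 : Measurable fun t =>
            radialIntegral g (s + t) t ^ 2 * ENNReal.ofReal (t ^ (σ - 2)) :=
          hmB.of_uncurry_left
        refine (setLIntegral_mono' measurableSet_Ioo fun t ht =>
          hg.diffKernel_add_le hα0 hα1 s ht.1 (ht.2.le.trans hT1)).trans_eq ?_
        exact lintegral_linearCombination hms1 hms2 (by finiteness) (by finiteness)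
          (by finiteness)
    _ = (4 * ∫⁻ s in Ioo c d, ∫⁻ t in Ioo 0 T,
          radialIntegral g s t ^ 2 * ENNReal.ofReal (t ^ (σ - 2))) +
        (4 * ∫⁻ s in Ioo c d, ∫⁻ t in Ioo 0 T,
          radialIntegral g (s + t) t ^ 2 * ENNReal.ofReal (t ^ (σ - 2))) +
        2 * ∫⁻ s in Ioo c d, ∫⁻ t in Ioo 0 T,
          (∫⁻ v in Ioo 0 t, gradDensity g t (s + v)) * ENNReal.ofReal (t ^ (σ - 1)) := by
        have hi1 : Measurable fun s => ∫⁻ t in Ioo 0 T,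
            radialIntegral g s t ^ 2 * ENNReal.ofReal (t ^ (σ - 2)) := hmA.lintegral_prod_right'
        have hi2 : Measurable fun s => ∫⁻ t in Ioo 0 T,
            radialIntegral g (s + t) t ^ 2 * ENNReal.ofReal (t ^ (σ - 2)) :=
          hmB.lintegral_prod_right'
        exact lintegral_linearCombination hi1 hi2 (by finiteness) (by finiteness)
          (by finiteness)
    _ ≤ 4 * (C * E) + 4 * (C * E) + 2 * E := by gcongr
    _ = _ := by ring

/-- Only the translations by `t < |I| / 2` are compared with the gradient. The path joining the two
points then stays over a rotate of `I` and at depths below `|I| / 2`. -/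
lemma ArcBound.shiftEnergy_of_gradEnergy {α M σ : ℝ} {g : ℝ → ℂ} (hg : PeriodicHolder α M g)
    (hα0 : 0 < α) (hα1 : α < 1) (hσ1 : σ < 1)
    (h : ArcBound (σ + 2 * α) (gradEnergy σ (1 / 2) g)) :
    ArcBound (σ + 2 * α) (shiftEnergy σ g) := by
  have hgc := hg.continuous hα0
  have hπ := Real.pi_gt_three
  obtain ⟨C, hC, hCT⟩ := hg.exists_setLIntegral_diffKernel_le hα0 hα1 hσ1
  have hXb : ArcBound (σ + 2 * α) fun J => C * gradEnergy σ (1 / 2) g J :=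
    h.mono hC fun J => le_rfl
  refine (((hXb.comp_rotate fun I => -((I.right - I.left) / 4)).add
    (hXb.comp_rotate fun I => (I.right - I.left) / 4)).add
    (hg.arcBound_diffKernel_of_len_le hα0 hσ1)).mono ENNReal.one_ne_top fun I => ?_
  rw [one_mul]
  have hlen := I.len_pos
  have hlen1 := I.len_le_one
  have hIL := I.right_sub_left
  have hm1 : Measurable fun s => ∫⁻ t in Ioo 0 (I.len / 2), diffKernel σ g s (s + t) :=
    (measurable_diffKernel_add hgc σ).lintegral_prod_right'
  refine (lintegral_mono fun s => setLIntegral_Ioo_le_add _ 0 (I.len / 2) I.len).trans ?_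
  rw [lintegral_add_left hm1]
  refine add_le_add_left (setLIntegral_angles_le_of_halves I
    (X := fun J => C * gradEnergy σ (1 / 2) g J) fun J c d hJ hc hd hcd hcd' => ?_) _
  refine (hCT c d (I.len / 2) (by linarith) (by linarith)).trans (mul_le_mul_right ?_ _)
  rw [gradEnergy, hJ, one_div_mul_eq_div]
  refine lintegral_mono_set (Ioo_subset_Ioo ?_ ?_)
  · rw [hIL] at hc; nlinarith
  · rw [hIL] at hd; nlinarith

/-! ### Carleson boxes in polar coordinates -/

lemma Arc.exp_mem_toSet_iff {I : Arc} {θ : ℝ} (hθ : θ ∈ Ioo I.left (I.left + 2 * Real.pi)) :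
    Circle.exp θ ∈ I.toSet ↔ θ ∈ I.angles := by
  refine ⟨?_, fun h => mem_image_of_mem _ h⟩
  rintro ⟨s, hs, hsθ⟩
  obtain ⟨m, hm⟩ := Circle.exp_eq_exp.1 hsθ
  have h1 := hs.1
  have h2 := hs.2.trans_le I.right_le
  have hm1 : (m : ℝ) < 1 := by nlinarith [hθ.1]
  have hm2 : (-1 : ℝ) < m := by nlinarith [hθ.2]
  have hm0 : m = 0 := by
    have : m < 1 := by exact_mod_cast hm1
    have : -1 < m := by exact_mod_cast hm2
    omega
  rw [hm0, Int.cast_zero, zero_mul, add_zero] at hm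
  exact hm ▸ hs

lemma Arc.measurableSet_coe_image_toSet (I : Arc) :
    MeasurableSet ((fun ζ : Circle => (ζ : ℂ)) '' I.toSet) := by
  rw [Arc.toSet, image_image]
  refine MeasurableSet.image_of_continuousOn_injOn measurableSet_Ioo (by fun_prop) ?_
  intro s hs t ht hst
  have h : Circle.exp s = Circle.exp t := Circle.ext hst
  obtain ⟨m, hm⟩ := Circle.exp_eq_exp.1 h
  have hπ := Real.pi_pos
  have hle := I.right_le
  have hm1 : (m : ℝ) < 1 := by nlinarith [hs.2, ht.1]
  have hm2 : (-1 : ℝ) < m := by nlinarith [hs.1, ht.2]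
  have hm0 : m = 0 := by
    have : m < 1 := by exact_mod_cast hm1
    have : -1 < m := by exact_mod_cast hm2
    omega
  rw [hm, hm0, Int.cast_zero, zero_mul, add_zero]

lemma Arc.measurableSet_box (I : Arc) : MeasurableSet I.box := by
  have h : I.box = ({z : ℂ | 1 - I.len ≤ ‖z‖} ∩ {z | ‖z‖ < 1}) ∩
      (fun z : ℂ => z / (‖z‖ : ℂ)) ⁻¹' ((fun ζ : Circle => (ζ : ℂ)) '' I.toSet) := by
    ext z
    simp only [Arc.box, mem_ofPred_eq, mem_inter_iff, mem_preimage, mem_image, and_assoc,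
      eq_comm (a := z / (‖z‖ : ℂ))]
  rw [h]
  exact ((measurableSet_le measurable_const measurable_norm).inter
    (measurableSet_lt measurable_norm measurable_const)).inter
    (I.measurableSet_coe_image_toSet.preimage (by fun_prop))

lemma Arc.polar_mem_box_iff (I : Arc) {r θ : ℝ} (hr : 0 < r)
    (hθ : θ ∈ Ioo I.left (I.left + 2 * Real.pi)) :
    (r : ℂ) * Complex.exp (θ * Complex.I) ∈ I.box ↔ r ∈ Ico (1 - I.len) 1 ∧ θ ∈ I.angles := by
  have hnorm : ‖(r : ℂ) * Complex.exp (θ * Complex.I)‖ = r := by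
    rw [norm_mul, Complex.norm_exp_ofReal_mul_I, mul_one, Complex.norm_of_nonneg hr.le]
  have hr' : (r : ℂ) ≠ 0 := by exact_mod_cast hr.ne'
  rw [Arc.box, mem_ofPred_eq, hnorm, mul_div_cancel_left₀ _ hr', ← Circle.coe_exp,
    ← Arc.exp_mem_toSet_iff hθ, mem_Ico, and_assoc]
  refine and_congr_right fun _ => and_congr_right fun _ => ⟨?_, fun h => ⟨_, h, rfl⟩⟩
  rintro ⟨ζ, hζ, h⟩
  rwa [Circle.ext h]

/-- Integration over a Carleson box in polar coordinates `z = (1 - y) e^{iθ}`. -/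
lemma Arc.setLIntegral_box (I : Arc) {F : ℂ → ENNReal} (hF : Measurable F) :
    ∫⁻ z in I.box, F z = ∫⁻ θ in I.angles, ∫⁻ y in Ioo 0 I.len,
      ENNReal.ofReal (1 - y) * F (polarPoint y θ) := by
  have hlen1 := I.len_le_one
  obtain ⟨G, hG⟩ : ∃ G : ℂ → ENNReal, G = I.box.indicator F := ⟨_, rfl⟩
  have hGm : Measurable G := hG ▸ hF.indicator I.measurableSet_box
  have hm : Measurable fun p : ℝ × ℝ =>
      ENNReal.ofReal p.1 * G ((p.1 : ℂ) * Complex.exp (p.2 * Complex.I)) := by fun_prop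
  have hper : Function.Periodic (fun θ : ℝ => ∫⁻ r in Ioi 0,
      ENNReal.ofReal r * G ((r : ℂ) * Complex.exp (θ * Complex.I))) (2 * Real.pi) := by
    intro θ
    have : Complex.exp (((θ + 2 * Real.pi : ℝ) : ℂ) * Complex.I) =
        Complex.exp (θ * Complex.I) := by
      rw [← Complex.exp_periodic (θ * Complex.I)]
      congr 1
      push_cast
      ring
    simp only [this]
  calc ∫⁻ z in I.box, F z = ∫⁻ z, G z := by rw [hG, lintegral_indicator I.measurableSet_box]
    _ = ∫⁻ p in Ioi (0 : ℝ) ×ˢ Ioo (-Real.pi) Real.pi,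
          ENNReal.ofReal p.1 * G ((p.1 : ℂ) * Complex.exp (p.2 * Complex.I)) := by
        rw [← Complex.lintegral_comp_polarCoord_symm, polarCoord_target]
        refine lintegral_congr fun p => ?_
        rw [smul_eq_mul, Complex.polarCoord_symm_apply, Complex.exp_mul_I, ← Complex.ofReal_cos,
          ← Complex.ofReal_sin]
    _ = ∫⁻ θ in Ioo (-Real.pi) (-Real.pi + 2 * Real.pi), ∫⁻ r in Ioi 0,
          ENNReal.ofReal r * G ((r : ℂ) * Complex.exp (θ * Complex.I)) := by
        rw [Measure.volume_eq_prod, ← Measure.prod_restrict, lintegral_prod_symm' _ hm,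
          show -Real.pi + 2 * Real.pi = Real.pi by ring]
    _ = ∫⁻ θ in Ioo I.left (I.left + 2 * Real.pi), ∫⁻ r in Ioi 0,
          ENNReal.ofReal r * G ((r : ℂ) * Complex.exp (θ * Complex.I)) :=
        setLIntegral_Ioo_period (by positivity) hper _ _
    _ = ∫⁻ θ in Ioo I.left (I.left + 2 * Real.pi), I.angles.indicator (fun θ =>
          ∫⁻ y in Ioo 0 I.len, ENNReal.ofReal (1 - y) * F (polarPoint y θ)) θ := by
        refine setLIntegral_congr_fun measurableSet_Ioo fun θ hθ => ?_
        by_cases hI : θ ∈ I.angles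
        · rw [indicator_of_mem hI]
          have hsub : Ioo (1 - I.len) 1 ⊆ Ico (1 - I.len) 1 ∩ Ioi 0 := fun r hr =>
            ⟨Ioo_subset_Ico_self hr, lt_of_le_of_lt (by linarith) hr.1⟩
          have hae : Ioo (1 - I.len) 1 =ᵐ[volume] (Ico (1 - I.len) 1 ∩ Ioi 0 : Set ℝ) :=
            hsub.eventuallyLE.antisymm
              (inter_subset_left.eventuallyLE.trans Ioo_ae_eq_Ico.symm.le)
          have h1 := setLIntegral_Ioo_comp_sub (fun r => ENNReal.ofReal r *
            F ((r : ℂ) * Complex.exp (θ * Complex.I))) 0 I.len 1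
          rw [sub_zero] at h1
          calc _ = ∫⁻ r in Ioi 0, (Ico (1 - I.len) 1).indicator (fun r => ENNReal.ofReal r *
                F ((r : ℂ) * Complex.exp (θ * Complex.I))) r := by
                refine setLIntegral_congr_fun measurableSet_Ioi fun r hr => ?_
                have := I.polar_mem_box_iff hr hθ
                by_cases h : r ∈ Ico (1 - I.len) 1
                · rw [indicator_of_mem h, hG, indicator_of_mem (this.2 ⟨h, hI⟩)]
                · rw [indicator_of_notMem h, hG, indicator_of_notMem fun h' => h (this.1 h').1,
                    mul_zero]
            _ = ∫⁻ r in Ioo (1 - I.len) 1, ENNReal.ofReal r *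
                  F ((r : ℂ) * Complex.exp (θ * Complex.I)) := by
                rw [setLIntegral_indicator measurableSet_Ico, setLIntegral_congr hae]
            _ = _ := h1.symm
        · rw [indicator_of_notMem hI]
          refine (setLIntegral_congr_fun measurableSet_Ioi fun r hr => ?_).trans lintegral_zero
          rw [hG, indicator_of_notMem fun h => hI ((I.polar_mem_box_iff hr hθ).1 h).2, mul_zero]
    _ = _ := by
        have hsub : I.angles ⊆ Ioo I.left (I.left + 2 * Real.pi) :=
          Ioo_subset_Ioo le_rfl I.right_le
        have hIm : MeasurableSet I.angles := measurableSet_Ioo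
        rw [setLIntegral_indicator hIm, inter_eq_left.2 hsub]

/-! ### The Carleson condition -/

lemma gradMeasure_box_eq {p β : ℝ} {f : Circle → ℂ} {g : ℝ → ℂ}
    (hg : Function.Periodic g (2 * Real.pi))
    (hfg : (fun s : ℝ => f (Circle.exp s)) =ᵐ[volume] g) (I : Arc) :
    gradMeasure p β f I.box = ENNReal.ofReal (1 / Real.pi) *
      ∫⁻ θ in I.angles, ∫⁻ y in Ioo 0 I.len, ENNReal.ofReal (1 - y) *
        (gradDensity g y θ * ENNReal.ofReal ((y * (2 - y)) ^ (p - 2 + 2 * β))) := by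
  have hsub : I.box ⊆ Metric.ball 0 1 := fun z hz => by simpa using hz.2.1
  have hm := measurable_gradSq (poissonAverage (boundaryFun g))
  rw [gradMeasure, areaMeasure, withDensity_smul_measure, Measure.smul_apply, smul_eq_mul,
    withDensity_apply', Measure.restrict_restrict I.measurableSet_box, inter_eq_left.2 hsub,
    poissonIntegral_eq_poissonAverage hg hfg, I.setLIntegral_box (by fun_prop)]
  congr 1
  refine lintegral_congr fun θ => setLIntegral_congr_fun measurableSet_Ioo fun y hy => ?_
  have hy1 : y ≤ 1 := hy.2.le.trans I.len_le_one
  have h0 : 0 ≤ gradSq (poissonAverage (boundaryFun g)) (polarPoint y θ) := by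
    unfold gradSq; positivity
  rw [norm_polarPoint hy1, ENNReal.ofReal_mul h0, gradDensity,
    show 1 - (1 - y) ^ 2 = y * (2 - y) by ring]

lemma isCarleson_gradMeasure_iff {p β : ℝ} {f : Circle → ℂ} :
    IsCarleson (p + 2 - 2 * β) (gradMeasure p β f) ↔
      ArcBound (p + 2 - 2 * β) fun I => gradMeasure p β f I.box := by
  rw [IsCarleson, ← iSup_ofReal_rpow_mul_lt_top_iff]
  have h : ∀ I : Arc, gradMeasure p β f I.box / ENNReal.ofReal (I.len ^ (p + 2 - 2 * β)) =
      ENNReal.ofReal (I.len ^ (-(p + 2 - 2 * β))) * gradMeasure p β f I.box := fun I => by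
    rw [Real.rpow_neg I.len_pos.le, ENNReal.ofReal_inv_of_pos (Real.rpow_pos_of_pos I.len_pos _),
      div_eq_mul_inv, mul_comm]
  simp only [h]

/-- The weight `1 - |z|² = y (2 - y)` is at most twice the distance `y` to the circle, and the
Jacobian `1 - y` of polar coordinates is at most `1`. -/
lemma gradMeasure_box_le {p β : ℝ} (hσ : 0 ≤ p - 2 + 2 * β) {f : Circle → ℂ} {g : ℝ → ℂ}
    (hg : Function.Periodic g (2 * Real.pi))
    (hfg : (fun s : ℝ => f (Circle.exp s)) =ᵐ[volume] g) (I : Arc) :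
    gradMeasure p β f I.box ≤ ENNReal.ofReal (1 / Real.pi) *
      ENNReal.ofReal (2 ^ (p - 2 + 2 * β)) * gradEnergy (p - 2 + 2 * β) 1 g I := by
  rw [gradMeasure_box_eq hg hfg, gradEnergy, mul_assoc, one_mul]
  refine mul_le_mul_right ?_ _
  rw [← lintegral_const_mul' _ _ ENNReal.ofReal_ne_top]
  refine lintegral_mono fun θ => ?_
  rw [← lintegral_const_mul' _ _ ENNReal.ofReal_ne_top]
  refine setLIntegral_mono' measurableSet_Ioo fun y hy => ?_
  have hy0 := hy.1
  have hy1 : y ≤ 1 := hy.2.le.trans I.len_le_one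
  calc _ ≤ 1 * (gradDensity g y θ * ENNReal.ofReal ((2 * y) ^ (p - 2 + 2 * β))) := by
        refine mul_le_mul' (by simpa using hy0.le) (mul_le_mul_right
          (ENNReal.ofReal_le_ofReal (Real.rpow_le_rpow (by nlinarith) (by nlinarith) hσ)) _)
    _ = _ := by
        rw [one_mul, Real.mul_rpow zero_le_two hy0.le, ENNReal.ofReal_mul (by positivity)]
        ring

/-- The converse of `gradMeasure_box_le` needs the half of the box next to the circle only: there
the Jacobian `1 - y` is at least `1 / 2`. -/
lemma gradEnergy_le_gradMeasure_box {p β : ℝ} (hσ : 0 ≤ p - 2 + 2 * β) {f : Circle → ℂ}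
    {g : ℝ → ℂ} (hg : Function.Periodic g (2 * Real.pi))
    (hfg : (fun s : ℝ => f (Circle.exp s)) =ᵐ[volume] g) (I : Arc) :
    gradEnergy (p - 2 + 2 * β) (1 / 2) g I ≤
      ENNReal.ofReal (2 * Real.pi) * gradMeasure p β f I.box := by
  rw [gradMeasure_box_eq hg hfg, ← mul_assoc, ← ENNReal.ofReal_mul (by positivity),
    show 2 * Real.pi * (1 / Real.pi) = 2 by field_simp, gradEnergy,
    ← lintegral_const_mul' _ _ ENNReal.ofReal_ne_top]
  refine lintegral_mono fun θ => ?_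
  rw [← lintegral_const_mul' _ _ ENNReal.ofReal_ne_top]
  have hlen := I.len_pos
  have hlen1 := I.len_le_one
  refine (setLIntegral_mono' measurableSet_Ioo fun y hy => ?_).trans
    (lintegral_mono_set (Ioo_subset_Ioo le_rfl (by linarith)))
  have hy0 := hy.1
  have hy1 : y ≤ 1 / 2 := by linarith [hy.2]
  rw [← mul_assoc, ← ENNReal.ofReal_mul zero_le_two]
  calc _ = 1 * (gradDensity g y θ * ENNReal.ofReal (y ^ (p - 2 + 2 * β))) := (one_mul _).symm
    _ ≤ _ := by
        refine mul_le_mul' (by rw [ENNReal.one_le_ofReal]; linarith) (mul_le_mul_right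
          (ENNReal.ofReal_le_ofReal (Real.rpow_le_rpow hy0.le (by nlinarith) hσ)) _)

end CircleQ

theorem mainTheorem1 (p β : ℝ) (hp0 : 0 < p) (hp1 : p < 1) (hβ0 : 1 / 2 < β) (hβ1 : β < 1)
    (hpβ : 0 < p - 2 + 2 * β) (f : Circle → ℂ) (hf : CircleQ.MemBMO β f) :
    List.TFAE [
      CircleQ.MemQ p β f,
      CircleQ.translationSup p β f < ⊤,
      CircleQ.IsCarleson (p + 2 - 2 * β) (CircleQ.gradMeasure p β f)] := by
  open CircleQ in
  obtain ⟨g, M, hM, hper, hHol, hfg⟩ := hf.exists_holder hβ1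
  have hg : PeriodicHolder (2 - 2 * β) M g := ⟨hM, hper, hHol⟩
  have hα0 : 0 < 2 - 2 * β := by linarith
  have hα1 : 2 - 2 * β < 1 := by linarith
  have hσ1 : p - 2 + 2 * β < 1 := by linarith
  have hq : p + 2 - 2 * β = (p - 2 + 2 * β) + 2 * (2 - 2 * β) := by ring
  rw [memQ_iff_arcBound hf.1 hfg, translationSup_lt_top_iff_arcBound (hg.continuous hα0) hfg,
    isCarleson_gradMeasure_iff, hq]
  have hdiff (h : ArcBound (p - 2 + 2 * β + 2 * (2 - 2 * β)) (chordEnergy (p - 2 + 2 * β) g)) :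
      ArcBound (p - 2 + 2 * β + 2 * (2 - 2 * β)) (diffEnergy (p - 2 + 2 * β) g) :=
    h.mono ENNReal.one_ne_top fun I => by
      rw [one_mul]; exact diffEnergy_le_chordEnergy hσ1 g I
  tfae_have 1 → 2 := fun h => (hdiff h).shiftEnergy_of_diffEnergy
  tfae_have 2 → 1 := fun h => (h.diffEnergy_of_shiftEnergy hg hα0 hσ1).chordEnergy_of_diffEnergy
    hg hα0 hpβ hσ1
  tfae_have 1 → 3 := fun h => ((hdiff h).gradEnergy_of_diffEnergy hg hα0 hα1 hpβ hσ1).mono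
    (by finiteness) (gradMeasure_box_le hpβ.le hper hfg)
  tfae_have 3 → 2 := fun h => (h.mono (by finiteness)
    (gradEnergy_le_gradMeasure_box hpβ.le hper hfg)).shiftEnergy_of_gradEnergy hg hα0 hα1 hσ1
  tfae_finish
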